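/- Let $G$ be a (finite-dimensional) Lie group with a bi-invariant Riemannian metric, let $B$ be the corresponding $\mathrm{Ad}$-invariant inner product on the Lie algebra $\mathfrak g=T_eG$, and let $K\subset H\subset G$ be closed connected subgroups with Lie algebras $\mathfrak k\subset\mathfrak h\subset\mathfrak g$. Give $G/K$ its standard manifold structure, for which the projection $\pi:G\to G/K$ is a smooth submersion, and put $o=eK$. Let $\mathfrak m_1=\mathfrak h^{\perp}\cong T_o(G/H)$ and $\mathfrak m_2=\mathfrak h\cap\mathfrak k^{\perp}\cong T_o(H/K)$, orthogonal complements being taken with respect to $B$. Let $\lambda>0$. Then: (i) $d\pi_e$ restricts to a linear isomorphism $\mathfrak m_1\oplus\mathfrak m_2\to T_o(G/K)$, and there is exactly one $G$-invariant Riemannian metric $g_\lambda$ on $G/K$ whose inner product at $o$ corresponds under this isomorphism to $B|_{\mathfrak m_1}+\lambda\,B|_{\mathfrak m_2}$. (ii) $(G/K,g_\lambda)$ is a two-step g.o. space, that is, every geodesic $\gamma$ of $(G/K,g_\lambda)$ with $\gamma(0)=o$ has the form $\gamma(t)=\exp(tX)\exp(tY)\cdot o$ for some $X,Y\in\mathfrak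 g$. More precisely, for all $X_1\in\mathfrak m_1$ and $X_2\in\mathfrak m_2$ the curve $$t\mapsto \exp t(X_1+\lambda X_2)\,\exp t(1-\lambda)X_2\cdot o,\qquad t\in\mathbb R,$$ is a geodesic of $(G/K,g_\lambda)$ through $o$ with initial velocity $d\pi_e(X_1+X_2)$, and every geodesic $\gamma$ with $\gamma(0)=o$ and $\dot\gamma(0)=d\pi_e(X_1+X_2)$, defined on an open interval containing $0$, coincides with this curve on that interval. -/

import Mathlib

open scoped Manifold ContDiff Topology

noncomputable section

namespace TwoStepGO

/-- The velocity vector `γ'(t)` of a curve, as an element of the tangent space at `γ t`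
(every tangent space of `M` is, by definition, a copy of the model space `E`). -/
def velocity (E : Type*) [NormedAddCommGroup E] [NormedSpace ℝ E]
    {M : Type*} [TopologicalSpace M] [ChartedSpace E M] (γ : ℝ → M) (t : ℝ) : E :=
  (mfderiv 𝓘(ℝ, ℝ) 𝓘(ℝ, E) γ t (1 : ℝ) : TangentSpace 𝓘(ℝ, E) (γ t))

theorem velocity_comp_mul {E : Type*} [NormedAddCommGroup E] [NormedSpace ℝ E]
    {M : Type*} [TopologicalSpace M] [ChartedSpace E M] {c : ℝ → M}
    (hc : ContMDiff 𝓘(ℝ, ℝ) 𝓘(ℝ, E) ∞ c) (a : ℝ) :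
    velocity E (fun t => c (a * t)) 0 = a • velocity E c 0 := by
  have h1 : HasMFDerivAt 𝓘(ℝ, ℝ) 𝓘(ℝ, ℝ) (fun t : ℝ => a * t) 0
      (a • ContinuousLinearMap.id ℝ ℝ) :=
    ((hasFDerivAt_id (0 : ℝ)).const_mul a).hasMFDerivAt
  have hcm : MDifferentiableAt 𝓘(ℝ, ℝ) 𝓘(ℝ, E) c (a * 0) := hc.mdifferentiableAt (by simp)
  have key := (hcm.hasMFDerivAt.comp (0 : ℝ) h1).mfderiv
  have h3 := DFunLike.congr_fun key (1 : ℝ)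
  unfold velocity
  refine h3.trans ?_
  have h4 := (mfderiv 𝓘(ℝ, ℝ) 𝓘(ℝ, E) c (a * 0)).map_smul a (1 : ℝ)
  have h5 : (mfderiv 𝓘(ℝ, ℝ) 𝓘(ℝ, E) c (a * 0) (1 : ℝ) : E)
      = mfderiv 𝓘(ℝ, ℝ) 𝓘(ℝ, E) c 0 (1 : ℝ) := by rw [mul_zero]
  exact h4.trans (congrArg (fun v : E => a • v) h5)

section Riemannian

variable {E : Type*} [NormedAddCommGroup E] [NormedSpace ℝ E]
  {M : Type*} [TopologicalSpace M] [ChartedSpace E M] [IsManifold 𝓘(ℝ, E) ∞ M]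

variable (E M) in
/-- Smooth Riemannian metrics on a smooth manifold `M` without boundary, modelled on the
vector space `E`. -/
abbrev SmoothMetric : Type _ :=
  Bundle.ContMDiffRiemannianMetric 𝓘(ℝ, E) ∞ E (fun x : M => TangentSpace 𝓘(ℝ, E) x)

/-- The metric coefficients `g_{uv}` in the preferred chart `φ` around `p`:
`x ↦ g_{φ⁻¹ x} (dφ⁻¹ u, dφ⁻¹ v)`, where `x` ranges over the target of the chart. -/
def chartMetric (g : SmoothMetric E M) (p : M) (x u v : E) : ℝ :=
  g.inner ((extChartAt 𝓘(ℝ, E) p).symm x)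
    (mfderiv 𝓘(ℝ, E) 𝓘(ℝ, E) (extChartAt 𝓘(ℝ, E) p).symm x u)
    (mfderiv 𝓘(ℝ, E) 𝓘(ℝ, E) (extChartAt 𝓘(ℝ, E) p).symm x v)

/-- The Christoffel symbol of the first kind of the metric `g` in the chart around `p`,
contracted twice with `u` and once with `w`:
`[ij,k] u^i u^j w^k = ½ (∂_i g_jk + ∂_j g_ik - ∂_k g_ij) u^i u^j w^k
  = D_u g (u, w) - ½ D_w g (u, u)`. -/
def chartChristoffel (g : SmoothMetric E M) (p : M) (x u w : E) : ℝ :=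
  fderiv ℝ (fun y => chartMetric g p y u w) x u
    - (1 / 2) * fderiv ℝ (fun y => chartMetric g p y u u) x w

/-- The curve `γ` is a geodesic on the open set `J` of times: it is smooth there, and in every
preferred chart its coordinate expression `c` satisfies `∇_{c'} c' = 0`, which, lowering the index
with the nondegenerate metric, reads `g (c'', w) + [ij,k] c'^i c'^j w^k = 0` for all `w`. -/
def IsGeodesicOn (g : SmoothMetric E M) (γ : ℝ → M) (J : Set ℝ) : Prop :=
  ContMDiffOn 𝓘(ℝ, ℝ) 𝓘(ℝ, E) ∞ γ J ∧
    ∀ t ∈ J, ∀ p : M, γ t ∈ (chartAt E p).source →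
      let c : ℝ → E := fun s => extChartAt 𝓘(ℝ, E) p (γ s)
      ∀ w : E, chartMetric g p (c t) (deriv (deriv c) t) w
        + chartChristoffel g p (c t) (deriv c t) w = 0

/-- The group `G` acts on `M` by isometries of the metric `g`. -/
def IsInvariantMetric (G : Type*) [SMul G M] (g : SmoothMetric E M) : Prop :=
  ∀ (a : G) (p : M) (u v : TangentSpace 𝓘(ℝ, E) p),
    g.inner (a • p) (mfderiv 𝓘(ℝ, E) 𝓘(ℝ, E) (fun q : M => a • q) p u)
      (mfderiv 𝓘(ℝ, E) 𝓘(ℝ, E) (fun q : M => a • q) p v) = g.inner p u v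

end Riemannian

section LieGroups

variable {E : Type*} [NormedAddCommGroup E] [NormedSpace ℝ E]
  {G : Type*} [TopologicalSpace G] [ChartedSpace E G] [Group G]

/-- The exponential map of a Lie group: `exp X = φ 1`, where `φ` is the integral curve through
the identity of the left-invariant vector field with value `X` at the identity, that is, the
one-parameter subgroup of `G` generated by `X`. -/
def lieExp (X : GroupLieAlgebra 𝓘(ℝ, E) G) : G :=
  haveI : Nonempty (ℝ → G) := ⟨fun _ => 1⟩
  Classical.epsilon
    (fun φ : ℝ → G => φ 0 = 1 ∧ IsMIntegralCurve φ (mulInvariantVectorField X)) 1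

/-- A Riemannian metric on `G` for which all left and all right translations are isometries. -/
def IsBiInvariant [LieGroup 𝓘(ℝ, E) ∞ G] (b : SmoothMetric E G) : Prop :=
  (∀ (a x : G) (u v : TangentSpace 𝓘(ℝ, E) x),
    b.inner (a * x) (mfderiv 𝓘(ℝ, E) 𝓘(ℝ, E) (fun y : G => a * y) x u)
      (mfderiv 𝓘(ℝ, E) 𝓘(ℝ, E) (fun y : G => a * y) x v) = b.inner x u v) ∧
  (∀ (a x : G) (u v : TangentSpace 𝓘(ℝ, E) x),
    b.inner (x * a) (mfderiv 𝓘(ℝ, E) 𝓘(ℝ, E) (fun y : G => y * a) x u)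
      (mfderiv 𝓘(ℝ, E) 𝓘(ℝ, E) (fun y : G => y * a) x v) = b.inner x u v)

theorem velocity_mul [LieGroup 𝓘(ℝ, E) ∞ G] {c d : ℝ → G}
    (hc : ContMDiff 𝓘(ℝ, ℝ) 𝓘(ℝ, E) ∞ c) (hd : ContMDiff 𝓘(ℝ, ℝ) 𝓘(ℝ, E) ∞ d)
    (hc0 : c 0 = 1) (hd0 : d 0 = 1) :
    velocity E (fun t => c t * d t) 0 = velocity E c 0 + velocity E d 0 := by
  have hcm : MDifferentiableAt 𝓘(ℝ, ℝ) 𝓘(ℝ, E) c 0 := hc.mdifferentiableAt (by simp)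
  have hdm : MDifferentiableAt 𝓘(ℝ, ℝ) 𝓘(ℝ, E) d 0 := hd.mdifferentiableAt (by simp)
  have hm : ContMDiff (𝓘(ℝ, ℝ).prod 𝓘(ℝ, ℝ)) 𝓘(ℝ, E) ∞ (fun p : ℝ × ℝ => c p.1 * d p.2) :=
    (hc.comp contMDiff_fst).mul (hd.comp contMDiff_snd)
  have hmd : MDifferentiableAt (𝓘(ℝ, ℝ).prod 𝓘(ℝ, ℝ)) 𝓘(ℝ, E)
      (fun p : ℝ × ℝ => c p.1 * d p.2) ((fun t : ℝ => (t, t)) 0) :=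
    hm.mdifferentiableAt (by simp)
  have hdiag : HasMFDerivAt 𝓘(ℝ, ℝ) (𝓘(ℝ, ℝ).prod 𝓘(ℝ, ℝ)) (fun t : ℝ => (t, t)) 0
      ((ContinuousLinearMap.id ℝ ℝ).prod (ContinuousLinearMap.id ℝ ℝ)) :=
    (hasMFDerivAt_id (0 : ℝ)).prodMk (hasMFDerivAt_id (0 : ℝ))
  have key := (HasMFDerivAt.comp (f := fun t : ℝ => (t, t))
    (g := fun p : ℝ × ℝ => c p.1 * d p.2) (0 : ℝ) hmd.hasMFDerivAt hdiag).mfderiv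
  have h2 := mfderiv_prod_eq_add_apply (v := ((1 : ℝ), (1 : ℝ))) hmd
  have e1 : velocity E (fun z : ℝ => c z * d 0) 0 = velocity E c 0 := by
    have : (fun z : ℝ => c z * d 0) = c := by funext z; rw [hd0, mul_one]
    rw [this]
  have e2 : velocity E (fun z : ℝ => c 0 * d z) 0 = velocity E d 0 := by
    have : (fun z : ℝ => c 0 * d z) = d := by funext z; rw [hc0, one_mul]
    rw [this]
  have h3 : velocity E (fun t => c t * d t) 0
      = velocity E (fun z : ℝ => c z * d 0) 0 + velocity E (fun z : ℝ => c 0 * d z) 0 :=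
    (DFunLike.congr_fun key (1 : ℝ)).trans h2
  rw [h3, e1, e2]

/-- The Lie algebra `T_e K ⊆ T_e G` of a closed subgroup `K` of the Lie group `G`: the velocity
vectors at the identity of the smooth curves of `G` that start at the identity and stay
in `K`. -/
def lieAlgebraOf [LieGroup 𝓘(ℝ, E) ∞ G] (K : Subgroup G) :
    Submodule ℝ (GroupLieAlgebra 𝓘(ℝ, E) G) where
  carrier := {X | ∃ c : ℝ → G, ContMDiff 𝓘(ℝ, ℝ) 𝓘(ℝ, E) ∞ c ∧ (∀ t, c t ∈ K) ∧ c 0 = 1 ∧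
    velocity E c 0 = X}
  add_mem' := by
    rintro X Y ⟨c, hc, hcK, hc0, hcX⟩ ⟨d, hd, hdK, hd0, hdY⟩
    refine ⟨fun t => c t * d t, hc.mul hd, fun t => K.mul_mem (hcK t) (hdK t),
      by simp [hc0, hd0], ?_⟩
    rw [velocity_mul hc hd hc0 hd0, hcX, hdY]
    rfl
  zero_mem' := by
    refine ⟨fun _ => 1, contMDiff_const, fun _ => K.one_mem, rfl, ?_⟩
    unfold velocity
    rw [mfderiv_const]
    rfl
  smul_mem' := by
    rintro a X ⟨c, hc, hcK, hc0, hcX⟩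
    refine ⟨fun t => c (a * t), hc.comp (contDiff_const.mul contDiff_id).contMDiff,
      fun t => hcK _, by simp [hc0], ?_⟩
    rw [velocity_comp_mul hc a, hcX]
    rfl

/-- The orthogonal complement of a subspace of the Lie algebra, with respect to the inner product
`B = b_e` on `T_e G` given by a Riemannian metric `b` on `G`. -/
def orthCompl [LieGroup 𝓘(ℝ, E) ∞ G] (b : SmoothMetric E G)
    (V : Submodule ℝ (GroupLieAlgebra 𝓘(ℝ, E) G)) :
    Submodule ℝ (GroupLieAlgebra 𝓘(ℝ, E) G) where
  carrier := {X | ∀ Y ∈ V, b.inner 1 X Y = 0}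
  add_mem' := by
    intro X X' hX hX' Y hY
    rw [map_add, _root_.add_apply, hX Y hY, hX' Y hY, add_zero]
  zero_mem' := by
    intro Y _
    rw [map_zero, _root_.zero_apply]
  smul_mem' := by
    intro a X hX Y hY
    rw [map_smul, _root_.smul_apply, hX Y hY, smul_zero]

/-- The subspace `𝔪₁ = 𝔥^⊥` of `𝔤`, identified with the tangent space of `G/H` at the origin. -/
def mOne [LieGroup 𝓘(ℝ, E) ∞ G] (b : SmoothMetric E G) (H : Subgroup G) :
    Submodule ℝ (GroupLieAlgebra 𝓘(ℝ, E) G) :=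
  orthCompl b (lieAlgebraOf H)

/-- The subspace `𝔪₂ = 𝔥 ∩ 𝔨^⊥` of `𝔤`, identified with the tangent space of `H/K` at the
origin. -/
def mTwo [LieGroup 𝓘(ℝ, E) ∞ G] (b : SmoothMetric E G) (K H : Subgroup G) :
    Submodule ℝ (GroupLieAlgebra 𝓘(ℝ, E) G) :=
  lieAlgebraOf H ⊓ orthCompl b (lieAlgebraOf K)

variable {E' : Type*} [NormedAddCommGroup E'] [NormedSpace ℝ E']

/-- The differential at the identity of the projection `π : G → G/K`, as a map from the Lie
algebra of `G` to the tangent space of `G/K` at the origin `o = eK`. -/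
def dProj (E' : Type*) [NormedAddCommGroup E'] [NormedSpace ℝ E'] (K : Subgroup G)
    [ChartedSpace E' (G ⧸ K)] :
    GroupLieAlgebra 𝓘(ℝ, E) G →L[ℝ] TangentSpace 𝓘(ℝ, E') (QuotientGroup.mk 1 : G ⧸ K) :=
  mfderiv 𝓘(ℝ, E) 𝓘(ℝ, E') (QuotientGroup.mk : G → G ⧸ K) 1

/-- `g` is the `G`-invariant Riemannian metric on `G/K` which at the origin is the inner product
`B|_{𝔪₁} + lam B|_{𝔪₂}` on `𝔪₁ ⊕ 𝔪₂ ≅ T_o(G/K)`. -/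
def IsDeformedMetric [LieGroup 𝓘(ℝ, E) ∞ G] (b : SmoothMetric E G) (K H : Subgroup G)
    [ChartedSpace E' (G ⧸ K)] [IsManifold 𝓘(ℝ, E') ∞ (G ⧸ K)] (lam : ℝ)
    (g : SmoothMetric E' (G ⧸ K)) : Prop :=
  IsInvariantMetric G g ∧
    ∀ X₁ ∈ mOne b H, ∀ X₂ ∈ mTwo b K H, ∀ Y₁ ∈ mOne b H, ∀ Y₂ ∈ mTwo b K H,
      g.inner (QuotientGroup.mk 1 : G ⧸ K) (dProj E' K (X₁ + X₂)) (dProj E' K (Y₁ + Y₂))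
        = b.inner 1 X₁ Y₁ + lam * b.inner 1 X₂ Y₂

/-- The curve `t ↦ exp(tX) exp(tY) · o` in `G/K`. -/
def twoStepCurve (K : Subgroup G) (X Y : GroupLieAlgebra 𝓘(ℝ, E) G) (t : ℝ) : G ⧸ K :=
  (lieExp (t • X) * lieExp (t • Y)) • (QuotientGroup.mk 1 : G ⧸ K)

/-- `(G/K, g)` is a two-step g.o. space: every geodesic `γ` through the origin, defined on an
arbitrary open interval of times containing `0`, is of the form `γ t = exp(tX) exp(tY) · o`. -/
def IsTwoStepGOSpace (E : Type*) [NormedAddCommGroup E] [NormedSpace ℝ E]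
    {G : Type*} [TopologicalSpace G] [ChartedSpace E G] [Group G] (K : Subgroup G)
    [ChartedSpace E' (G ⧸ K)] [IsManifold 𝓘(ℝ, E') ∞ (G ⧸ K)]
    (g : SmoothMetric E' (G ⧸ K)) : Prop :=
  ∀ (J : Set ℝ) (γ : ℝ → G ⧸ K), IsOpen J → J.OrdConnected → (0 : ℝ) ∈ J →
    IsGeodesicOn g γ J → γ 0 = QuotientGroup.mk 1 →
    ∃ X Y : GroupLieAlgebra 𝓘(ℝ, E) G, ∀ t ∈ J, γ t = twoStepCurve K X Y t

end LieGroups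

end TwoStepGO

end

/-!
The differential of `π` at the identity has kernel `𝔨` and is therefore an isomorphism of
`𝔪₁ ⊕ 𝔪₂ = 𝔨^⊥` onto `T_o(G/K)`. The inner product `B|_{𝔪₁} + lam B|_{𝔪₂}` is `Ad(K)`-invariant,
since `Ad(K)` preserves `𝔥` and `𝔨`, and translating it around gives `g_lam`.

By Noether's theorem a curve `γ` in `G/K` is a geodesic of an invariant metric as soon as its
momentum `Z ↦ g(γ', Z^*)` along all fundamental fields `Z^*` is constant: every `exp(sZ)` is an
isometry, so the first variation of the energy of `γ` under `exp(sZ)` vanishes, and the fields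
`Z^*` span every tangent space. For `γ t = exp(tA) exp(tC) · o` with `A = X₁ + lam X₂` and
`C = (1 - lam) X₂` the velocity is the translate by `exp(tA) exp(tC)` of `dπ(Ad(d⁻¹) A + C)`, with
`d = exp(tC)`. Here `Ad(d⁻¹)` fixes `X₂` and preserves `𝔪₁`, so that `Ad(d⁻¹) A + C` has components
`Ad(d⁻¹) X₁` and `X₂`, and the metric endomorphism sends it back to `Ad(d⁻¹) A`. The momentum of
`γ` is therefore the constant functional `Z ↦ B(A, Z)`, by `Ad`-invariance of `B` and
`Ad(exp(tA)) A = A`. Every initial velocity is `dπ(X₁ + X₂)`, so uniqueness of solutions of the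
geodesic equation gives all geodesics through `o`.
-/

noncomputable section

namespace TwoStepGO

section Calculus

variable (E : Type*) [NormedAddCommGroup E] [NormedSpace ℝ E]
  (F : Type*) [NormedAddCommGroup F] [NormedSpace ℝ F]
  (F' : Type*) [NormedAddCommGroup F'] [NormedSpace ℝ F']
  {M : Type*} [TopologicalSpace M] [ChartedSpace E M]
  {N : Type*} [TopologicalSpace N] [ChartedSpace F N]
  {P : Type*} [TopologicalSpace P] [ChartedSpace F' P]

/-- The derivative of a map between manifolds, as a map between the model spaces. Forgetting the
dependence of `mfderiv` on the base point makes derivatives at varying points comparable. -/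
def mderiv (f : M → N) (x : M) : E →L[ℝ] F := mfderiv 𝓘(ℝ, E) 𝓘(ℝ, F) f x

theorem velocity_eq_mderiv (γ : ℝ → M) (t : ℝ) : velocity E γ t = mderiv ℝ E γ t 1 := rfl

variable {E F F'}

theorem mderiv_comp {g : N → P} {f : M → N} {x : M} {y : N}
    (hg : MDifferentiableAt 𝓘(ℝ, F) 𝓘(ℝ, F') g y) (hf : MDifferentiableAt 𝓘(ℝ, E) 𝓘(ℝ, F) f x)
    (hy : f x = y) :
    mderiv E F' (fun z => g (f z)) x = (mderiv F F' g y).comp (mderiv E F f x) := by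
  subst hy
  exact mfderiv_comp x hg hf

theorem mderiv_congr {f g : M → N} {x : M} (h : f =ᶠ[𝓝 x] g) : mderiv E F f x = mderiv E F g x :=
  h.mfderiv_eq

theorem mderiv_id (x : M) : mderiv E E (fun y : M => y) x = ContinuousLinearMap.id ℝ E :=
  mfderiv_id

theorem mderiv_const (x : M) (c : N) : mderiv E F (fun _ : M => c) x = 0 :=
  mfderiv_const

theorem mderiv_eq_fderiv (f : E → F) (x : E) : mderiv E F f x = fderiv ℝ f x :=
  mfderiv_eq_fderiv

theorem velocity_eq_deriv (f : ℝ → F) (t : ℝ) : velocity F f t = deriv f t := by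
  rw [velocity_eq_mderiv, mderiv_eq_fderiv]; simp

theorem velocity_comp {f : M → N} {γ : ℝ → M} {t : ℝ} {y : M}
    (hf : MDifferentiableAt 𝓘(ℝ, E) 𝓘(ℝ, F) f y)
    (hγ : MDifferentiableAt 𝓘(ℝ, ℝ) 𝓘(ℝ, E) γ t) (hy : γ t = y) :
    velocity F (fun s => f (γ s)) t = mderiv E F f y (velocity E γ t) := by
  rw [velocity_eq_mderiv, mderiv_comp hf hγ hy]; rfl

theorem velocity_comp₂ {f : M → N → P} {c : ℝ → M} {d : ℝ → N} {t : ℝ}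
    (hf : MDifferentiableAt (𝓘(ℝ, E).prod 𝓘(ℝ, F)) 𝓘(ℝ, F') (fun p : M × N => f p.1 p.2)
      (c t, d t))
    (hc : MDifferentiableAt 𝓘(ℝ, ℝ) 𝓘(ℝ, E) c t) (hd : MDifferentiableAt 𝓘(ℝ, ℝ) 𝓘(ℝ, F) d t) :
    velocity F' (fun s => f (c s) (d s)) t
      = mderiv E F' (fun x => f x (d t)) (c t) (velocity E c t)
        + mderiv F F' (fun y => f (c t) y) (d t) (velocity F d t) := by
  have hcd : HasMFDerivAt 𝓘(ℝ, ℝ) (𝓘(ℝ, E).prod 𝓘(ℝ, F)) (fun s => (c s, d s)) t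
      ((mfderiv 𝓘(ℝ, ℝ) 𝓘(ℝ, E) c t).prod (mfderiv 𝓘(ℝ, ℝ) 𝓘(ℝ, F) d t)) :=
    hc.hasMFDerivAt.prodMk hd.hasMFDerivAt
  have key := (HasMFDerivAt.comp (f := fun s => (c s, d s))
    (g := fun p : M × N => f p.1 p.2) t hf.hasMFDerivAt hcd).mfderiv
  exact (DFunLike.congr_fun key (1 : ℝ)).trans (mfderiv_prod_eq_add_apply
    (v := (velocity E c t, velocity F d t)) hf)

variable [IsManifold 𝓘(ℝ, E) ∞ M]

theorem contMDiffAt_extChartAt_symm {p : M} {x : E} (hx : x ∈ (extChartAt 𝓘(ℝ, E) p).target) :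
    ContMDiffAt 𝓘(ℝ, E) 𝓘(ℝ, E) ∞ (extChartAt 𝓘(ℝ, E) p).symm x :=
  (contMDiffOn_extChartAt_symm p).contMDiffAt ((isOpen_extChartAt_target p).mem_nhds hx)

theorem mdifferentiableAt_extChartAt_symm {p : M} {x : E}
    (hx : x ∈ (extChartAt 𝓘(ℝ, E) p).target) :
    MDifferentiableAt 𝓘(ℝ, E) 𝓘(ℝ, E) (extChartAt 𝓘(ℝ, E) p).symm x :=
  (contMDiffAt_extChartAt_symm hx).mdifferentiableAt (by simp)

theorem mderiv_extChartAt_symm_comp {p q : M} (hq : q ∈ (chartAt E p).source) :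
    (mderiv E E (extChartAt 𝓘(ℝ, E) p).symm (extChartAt 𝓘(ℝ, E) p q)).comp
      (mderiv E E (extChartAt 𝓘(ℝ, E) p) q) = ContinuousLinearMap.id ℝ E := by
  have hq' : q ∈ (extChartAt 𝓘(ℝ, E) p).source := by simpa using hq
  rw [← mderiv_comp (mdifferentiableAt_extChartAt_symm
    ((extChartAt 𝓘(ℝ, E) p).map_source hq'))
    (mdifferentiableAt_extChartAt hq) rfl, ← mderiv_id q]
  refine mderiv_congr ?_
  filter_upwards [(chartAt E p).open_source.mem_nhds hq] with z hz
  exact (extChartAt 𝓘(ℝ, E) p).left_inv (by simpa using hz)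

theorem mderiv_extChartAt_comp_symm {p : M} {x : E} (hx : x ∈ (extChartAt 𝓘(ℝ, E) p).target) :
    (mderiv E E (extChartAt 𝓘(ℝ, E) p) ((extChartAt 𝓘(ℝ, E) p).symm x)).comp
      (mderiv E E (extChartAt 𝓘(ℝ, E) p).symm x) = ContinuousLinearMap.id ℝ E := by
  have hq' : (extChartAt 𝓘(ℝ, E) p).symm x ∈ (chartAt E p).source := by
    simpa using (extChartAt 𝓘(ℝ, E) p).map_target hx
  rw [← mderiv_comp (mdifferentiableAt_extChartAt hq')
    (mdifferentiableAt_extChartAt_symm hx) rfl, ← mderiv_id x]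
  refine mderiv_congr ?_
  filter_upwards [(isOpen_extChartAt_target p).mem_nhds hx] with z hz
  exact (extChartAt 𝓘(ℝ, E) p).right_inv hz

theorem mderiv_extChartAt_self (p : M) :
    mderiv E E (extChartAt 𝓘(ℝ, E) p) p = ContinuousLinearMap.id ℝ E :=
  mfderiv_extChartAt_self

theorem mderiv_extChartAt_symm_self (p : M) :
    mderiv E E (extChartAt 𝓘(ℝ, E) p).symm (extChartAt 𝓘(ℝ, E) p p)
      = ContinuousLinearMap.id ℝ E := by
  have h := mderiv_extChartAt_symm_comp (mem_chart_source E p)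
  rwa [mderiv_extChartAt_self, ContinuousLinearMap.comp_id] at h

theorem contMDiffAt_mderiv_inCharts [IsManifold 𝓘(ℝ, F) ∞ N]
    {EP : Type*} [NormedAddCommGroup EP] [NormedSpace ℝ EP]
    {Q : Type*} [TopologicalSpace Q] [ChartedSpace EP Q] [IsManifold 𝓘(ℝ, EP) ∞ Q]
    {f : Q → M → N} {g : Q → M} {q₀ : Q}
    (hf : ContMDiffAt (𝓘(ℝ, EP).prod 𝓘(ℝ, E)) 𝓘(ℝ, F) ∞ (fun p : Q × M => f p.1 p.2) (q₀, g q₀))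
    (hg : ContMDiffAt 𝓘(ℝ, EP) 𝓘(ℝ, E) ∞ g q₀) :
    ContMDiffAt 𝓘(ℝ, EP) 𝓘(ℝ, E →L[ℝ] F) ∞
      (fun q => (mderiv F F (extChartAt 𝓘(ℝ, F) (f q₀ (g q₀))) (f q (g q))).comp
        ((mderiv E F (f q) (g q)).comp
          (mderiv E E (extChartAt 𝓘(ℝ, E) (g q₀)).symm (extChartAt 𝓘(ℝ, E) (g q₀) (g q))))) q₀ := by
  have h := ContMDiffAt.mfderiv (m := ∞) f g hf hg (by simp)
  refine h.congr_of_eventuallyEq ?_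
  have hfg : ContinuousAt (fun q => f q (g q)) q₀ :=
    ContinuousAt.comp (f := fun q => (q, g q)) (x := q₀) hf.continuousAt
      (continuousAt_id.prodMk hg.continuousAt)
  filter_upwards [hg.continuousAt.preimage_mem_nhds
    ((chartAt E (g q₀)).open_source.mem_nhds (mem_chart_source E (g q₀))),
    hfg.preimage_mem_nhds ((chartAt F (f q₀ (g q₀))).open_source.mem_nhds
      (mem_chart_source F (f q₀ (g q₀))))] with q h1 h2
  refine Eq.trans ?_ (inTangentCoordinates_eq_mfderiv_comp h1 h2).symm
  simp only [mderiv, modelWithCornersSelf_coe, Set.range_id, mfderivWithin_univ]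
  rfl

end Calculus

section BilinearForms

variable {E : Type*} [NormedAddCommGroup E] [NormedSpace ℝ E]
  {F : Type*} [NormedAddCommGroup F] [NormedSpace ℝ F]

section Pullback

variable {P : Type*} [NormedAddCommGroup P] [NormedSpace ℝ P]
  {N : Type*} [TopologicalSpace N] [ChartedSpace P N]

/-- The pullback `A^* B` of a bilinear form `B` under a linear map `A`. -/
def pullForm (B : F →L[ℝ] F →L[ℝ] ℝ) (A : E →L[ℝ] F) : E →L[ℝ] E →L[ℝ] ℝ := B.bilinearComp A A

@[simp]
theorem pullForm_apply (B : F →L[ℝ] F →L[ℝ] ℝ) (A : E →L[ℝ] F) (u v : E) :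
    pullForm B A u v = B (A u) (A v) := rfl

theorem contDiff_flip {n : WithTop ℕ∞} : ContDiff ℝ n (fun f : E →L[ℝ] F →L[ℝ] P => f.flip) :=
  ContinuousLinearMap.contDiff (E := E →L[ℝ] F →L[ℝ] P) (F := F →L[ℝ] E →L[ℝ] P)
    ((ContinuousLinearMap.flipₗᵢ ℝ E F P).toContinuousLinearEquiv : _ →L[ℝ] _)

theorem contDiff_pullForm :
    ContDiff ℝ ∞ (fun p : (F →L[ℝ] F →L[ℝ] ℝ) × (E →L[ℝ] F) => pullForm p.1 p.2) := by
  have h : ContDiff ℝ ∞ (fun p : (F →L[ℝ] F →L[ℝ] ℝ) × (E →L[ℝ] F) => p.1.comp p.2) :=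
    contDiff_fst.clm_comp contDiff_snd
  exact contDiff_flip.comp ((contDiff_flip.comp h).clm_comp contDiff_snd)

theorem contMDiffAt_pullForm {b : N → F →L[ℝ] F →L[ℝ] ℝ} {A : N → E →L[ℝ] F} {q : N}
    (hb : ContMDiffAt 𝓘(ℝ, P) 𝓘(ℝ, F →L[ℝ] F →L[ℝ] ℝ) ∞ b q)
    (hA : ContMDiffAt 𝓘(ℝ, P) 𝓘(ℝ, E →L[ℝ] F) ∞ A q) :
    ContMDiffAt 𝓘(ℝ, P) 𝓘(ℝ, E →L[ℝ] E →L[ℝ] ℝ) ∞ (fun x => pullForm (b x) (A x)) q :=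
  contDiff_pullForm.contMDiff.contMDiffAt.comp (f := fun x => (b x, A x)) q (hb.prodMk_space hA)

theorem exists_pullForm_eq [FiniteDimensional ℝ F] {Q : E →L[ℝ] E →L[ℝ] ℝ} {T : E →L[ℝ] F}
    (hT : Function.Surjective T) (hl : ∀ X Y, T X = 0 → Q X Y = 0)
    (hr : ∀ X Y, T Y = 0 → Q X Y = 0) : ∃ q : F →L[ℝ] F →L[ℝ] ℝ, pullForm q T = Q := by
  obtain ⟨S, hS⟩ := (T : E →ₗ[ℝ] F).exists_rightInverse_of_surjective (LinearMap.range_eq_top.2 hT)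
  have hTS : ∀ X, T (S (T X) - X) = 0 := fun X => by
    rw [map_sub, sub_eq_zero]
    exact DFunLike.congr_fun hS (T X)
  refine ⟨pullForm Q S.toContinuousLinearMap, ?_⟩
  ext X Y
  have hX := hl _ (S (T Y)) (hTS X)
  have hY := hr X _ (hTS Y)
  rw [map_sub, _root_.sub_apply, sub_eq_zero] at hX
  rw [map_sub, sub_eq_zero] at hY
  exact hX.trans hY

end Pullback

/-- Positive definiteness of a bilinear form. Symmetry is not part of the definition. -/
def IsPosDef (B : E →L[ℝ] E →L[ℝ] ℝ) : Prop := ∀ u, u ≠ 0 → 0 < B u u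

variable {B : E →L[ℝ] E →L[ℝ] ℝ}

theorem IsPosDef.pullForm {A : F →L[ℝ] E} (hB : IsPosDef B) (hA : Function.Injective A) :
    IsPosDef (pullForm B A) :=
  fun _ hu => hB _ ((map_ne_zero_iff A hA).2 hu)

theorem IsPosDef.injective (hB : IsPosDef B) : Function.Injective B := by
  rw [injective_iff_map_eq_zero]
  intro u hu
  by_contra hne
  simpa [hu] using hB u hne

theorem IsPosDef.eq_of_forall_mem (hB : IsPosDef B) {V : Submodule ℝ E} {X Y : E} (hX : X ∈ V)
    (hY : Y ∈ V) (h : ∀ Z ∈ V, B X Z = B Y Z) : X = Y := by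
  by_contra hne
  have hpos := hB (X - Y) (sub_ne_zero.2 hne)
  rw [map_sub B, _root_.sub_apply, h _ (V.sub_mem hX hY), sub_self] at hpos
  exact lt_irrefl _ hpos

theorem IsPosDef.eq_and_eq_of_add_sub_add_mem (hB : IsPosDef B) {V W : Submodule ℝ E}
    (hVW : V ≤ W) {X₁ X₂ Y₁ Y₂ : E}
    (hX₁ : ∀ Z ∈ W, B X₁ Z = 0) (hX₂ : X₂ ∈ W) (hX₂' : ∀ Z ∈ V, B X₂ Z = 0)
    (hY₁ : ∀ Z ∈ W, B Y₁ Z = 0) (hY₂ : Y₂ ∈ W) (hY₂' : ∀ Z ∈ V, B Y₂ Z = 0)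
    (h : X₁ + X₂ - (Y₁ + Y₂) ∈ V) : X₁ = Y₁ ∧ X₂ = Y₂ := by
  have h₁ : X₁ = Y₁ := by
    rw [← sub_eq_zero]
    refine hB.eq_of_forall_mem (V := W) ?_ W.zero_mem fun Z hZ => ?_
    · convert W.sub_mem (hVW h) (W.sub_mem hX₂ hY₂) using 1
      abel
    · simp [hX₁ Z hZ, hY₁ Z hZ]
  have h₂ : X₂ - Y₂ = 0 := by
    refine hB.eq_of_forall_mem ?_ V.zero_mem fun Z hZ => ?_
    · simpa [h₁] using h
    · simp [hX₂' Z hZ, hY₂' Z hZ]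
  exact ⟨h₁, sub_eq_zero.1 h₂⟩

section FiniteDimensional

variable [FiniteDimensional ℝ E]

theorem IsPosDef.isInvertible (hB : IsPosDef B) : B.IsInvertible := by
  have hdim : Module.finrank ℝ E = Module.finrank ℝ (E →L[ℝ] ℝ) := by
    rw [← (LinearMap.toContinuousLinearMap (𝕜 := ℝ) (E := E) (F' := ℝ)).finrank_eq]
    exact Subspace.dual_finrank_eq.symm
  exact ⟨(LinearMap.linearEquivOfInjective (B : E →ₗ[ℝ] E →L[ℝ] ℝ) hB.injective
    hdim).toContinuousLinearEquiv, by ext; rfl⟩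

theorem IsPosDef.exists_pos_mul_sq_le (hB : IsPosDef B) : ∃ c > 0, ∀ v, c * ‖v‖ ^ 2 ≤ B v v := by
  have : ProperSpace E := FiniteDimensional.proper ℝ E
  obtain ⟨c, hc, hle⟩ := (isCompact_sphere (0 : E) 1).exists_forall_le' (f := fun v => B v v)
    (by fun_prop) (a := 0) fun u hu => hB u (by rintro rfl; simp at hu)
  refine ⟨c, hc, fun v => ?_⟩
  rcases eq_or_ne v 0 with rfl | hv
  · simp
  have hn : 0 < ‖v‖ := norm_pos_iff.2 hv
  have hunit := hle (‖v‖⁻¹ • v) (by simp [norm_smul, hn.ne'])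
  simp only [map_smul, _root_.smul_apply, smul_eq_mul] at hunit
  refine (mul_le_mul_of_nonneg_right hunit (sq_nonneg ‖v‖)).trans_eq ?_
  field_simp

theorem IsPosDef.isVonNBounded (hB : IsPosDef B) :
    Bornology.IsVonNBounded ℝ {v : E | B v v < 1} := by
  obtain ⟨c, hc, hle⟩ := hB.exists_pos_mul_sq_le
  refine (NormedSpace.isVonNBounded_iff' ℝ).2 ⟨√(1 / c), fun v (hv : B v v < 1) => ?_⟩
  refine Real.le_sqrt_of_sq_le ((le_div_iff₀ hc).2 ?_)
  linarith [hle v]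

end FiniteDimensional

end BilinearForms

section OrthogonalProjection

variable {E : Type*} [NormedAddCommGroup E] [NormedSpace ℝ E]

/-- The orthogonal projection onto `V` with respect to a positive definite bilinear form `B`: the
vector of `V` that represents the functional `B X` restricted to `V`. -/
def orthProj (B : E →L[ℝ] E →L[ℝ] ℝ) (V : Submodule ℝ E) : E →L[ℝ] E :=
  V.subtypeL.comp ((pullForm B V.subtypeL).inverse.comp
    (((ContinuousLinearMap.compL ℝ V E ℝ).flip V.subtypeL).comp B))

variable {B : E →L[ℝ] E →L[ℝ] ℝ} {V W : Submodule ℝ E} {X Y : E}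

theorem orthProj_mem (X : E) : orthProj B V X ∈ V := Submodule.coe_mem _

variable [FiniteDimensional ℝ E]

theorem apply_orthProj_left (hB : IsPosDef B) (X : E) (hY : Y ∈ V) :
    B (orthProj B V X) Y = B X Y := by
  have hV : (pullForm B V.subtypeL).IsInvertible :=
    (hB.pullForm (A := V.subtypeL) V.subtype_injective).isInvertible
  exact DFunLike.congr_fun (hV.self_apply_inverse ((B X).comp V.subtypeL)) (⟨Y, hY⟩ : V)

theorem orthProj_eq (hB : IsPosDef B) (hY : Y ∈ V) (h : ∀ Z ∈ V, B Y Z = B X Z) :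
    orthProj B V X = Y :=
  hB.eq_of_forall_mem (orthProj_mem X) hY fun Z hZ =>
    (apply_orthProj_left hB X hZ).trans (h Z hZ).symm

theorem orthProj_of_mem (hB : IsPosDef B) (hX : X ∈ V) : orthProj B V X = X :=
  orthProj_eq hB hX fun _ _ => rfl

theorem orthProj_of_orth (hB : IsPosDef B) (hX : ∀ Z ∈ V, B X Z = 0) : orthProj B V X = 0 :=
  orthProj_eq hB V.zero_mem fun Z hZ => by simp [hX Z hZ]

theorem orthProj_selfAdjoint (hB : IsPosDef B) (hsymm : ∀ X Y, B X Y = B Y X) (X Y : E) :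
    B (orthProj B V X) Y = B X (orthProj B V Y) := by
  rw [hsymm, ← apply_orthProj_left hB Y (orthProj_mem X), hsymm,
    apply_orthProj_left hB X (orthProj_mem Y)]

theorem orthProj_comm (hB : IsPosDef B) {A A' : E →L[ℝ] E} (hA : ∀ X Y, B (A X) (A Y) = B X Y)
    (hAV : ∀ X ∈ V, A X ∈ V) (hAV' : ∀ X ∈ V, A' X ∈ V) (hAA' : ∀ X, A (A' X) = X) (X : E) :
    orthProj B V (A X) = A (orthProj B V X) := by
  refine orthProj_eq hB (hAV _ (orthProj_mem X)) fun Y hY => ?_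
  rw [← hAA' Y, hA, hA, apply_orthProj_left hB X (hAV' Y hY)]

theorem exists_eq_add_add (hB : IsPosDef B) (hVW : V ≤ W) (X : E) :
    ∃ X₁ X₂ Z, (∀ Y ∈ W, B X₁ Y = 0) ∧ (X₂ ∈ W ∧ ∀ Y ∈ V, B X₂ Y = 0) ∧ Z ∈ V ∧
      X = X₁ + X₂ + Z := by
  refine ⟨X - orthProj B W X, orthProj B W X - orthProj B V X, orthProj B V X, fun Y hY => ?_,
    ⟨W.sub_mem (orthProj_mem X) (hVW (orthProj_mem X)), fun Y hY => ?_⟩, orthProj_mem X, by abel⟩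
  · rw [map_sub, _root_.sub_apply, apply_orthProj_left hB X hY, sub_self]
  · rw [map_sub, _root_.sub_apply, apply_orthProj_left hB X (hVW hY), apply_orthProj_left hB X hY,
      sub_self]

end OrthogonalProjection

section Deformation

variable {E : Type*} [NormedAddCommGroup E] [NormedSpace ℝ E]

/-- For subspaces `V ≤ W`, the operator that is `1` on `W^⊥`, `lam` on `W ∩ V^⊥` and `0` on `V`.
It expresses the deformed inner product through the original one. -/
def deformOp (B : E →L[ℝ] E →L[ℝ] ℝ) (V W : Submodule ℝ E) (lam : ℝ) : E →L[ℝ] E :=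
  ContinuousLinearMap.id ℝ E - orthProj B W + lam • (orthProj B W - orthProj B V)

/-- For subspaces `V ≤ W`, the form `B|_{W^⊥} + lam B|_{W ∩ V^⊥}`, extended by zero to `V`. -/
def deformedForm (B : E →L[ℝ] E →L[ℝ] ℝ) (V W : Submodule ℝ E) (lam : ℝ) :
    E →L[ℝ] E →L[ℝ] ℝ :=
  B.comp (deformOp B V W lam)

variable {B : E →L[ℝ] E →L[ℝ] ℝ} {V W : Submodule ℝ E} {lam : ℝ} {X Y X₁ X₂ Y₁ Y₂ : E}

theorem deformOp_apply (X : E) : deformOp B V W lam X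
    = X - orthProj B W X + lam • (orthProj B W X - orthProj B V X) := rfl

theorem deformedForm_apply (X Y : E) :
    deformedForm B V W lam X Y = B (deformOp B V W lam X) Y := rfl

variable [FiniteDimensional ℝ E]

theorem deformOp_of_mem (hB : IsPosDef B) (hVW : V ≤ W) (hX : X ∈ V) :
    deformOp B V W lam X = 0 := by
  simp [deformOp_apply, orthProj_of_mem hB hX, orthProj_of_mem hB (hVW hX)]

theorem deformOp_add (hB : IsPosDef B) (hVW : V ≤ W) (hX₁ : ∀ Z ∈ W, B X₁ Z = 0) (hX₂ : X₂ ∈ W)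
    (hX₂' : ∀ Z ∈ V, B X₂ Z = 0) : deformOp B V W lam (X₁ + X₂) = X₁ + lam • X₂ := by
  simp [deformOp_apply, orthProj_of_orth hB hX₁, orthProj_of_orth hB fun Z hZ => hX₁ Z (hVW hZ),
    orthProj_of_orth hB hX₂', orthProj_of_mem hB hX₂]

theorem deformOp_comm (hB : IsPosDef B) {A A' : E →L[ℝ] E} (hA : ∀ X Y, B (A X) (A Y) = B X Y)
    (hAV : ∀ X ∈ V, A X ∈ V) (hAV' : ∀ X ∈ V, A' X ∈ V) (hAW : ∀ X ∈ W, A X ∈ W)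
    (hAW' : ∀ X ∈ W, A' X ∈ W) (hAA' : ∀ X, A (A' X) = X) (X : E) :
    deformOp B V W lam (A X) = A (deformOp B V W lam X) := by
  simp only [deformOp_apply, orthProj_comm hB hA hAV hAV' hAA', orthProj_comm hB hA hAW hAW' hAA',
    map_add, map_sub, map_smul]

theorem deformedForm_symm (hB : IsPosDef B) (hsymm : ∀ X Y, B X Y = B Y X) (X Y : E) :
    deformedForm B V W lam X Y = deformedForm B V W lam Y X := by
  simp only [deformedForm_apply, deformOp_apply, map_add, map_sub, map_smul, _root_.add_apply,
    _root_.sub_apply, _root_.smul_apply, orthProj_selfAdjoint hB hsymm X Y]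
  simp only [hsymm X]

theorem deformedForm_eq_zero_of_mem_left (hB : IsPosDef B) (hVW : V ≤ W) (hX : X ∈ V) (Y : E) :
    deformedForm B V W lam X Y = 0 := by
  simp [deformedForm_apply, deformOp_of_mem hB hVW hX]

theorem deformedForm_add_add (hB : IsPosDef B) (hsymm : ∀ X Y, B X Y = B Y X) (hVW : V ≤ W)
    (hX₁ : ∀ Z ∈ W, B X₁ Z = 0) (hX₂ : X₂ ∈ W) (hX₂' : ∀ Z ∈ V, B X₂ Z = 0)
    (hY₁ : ∀ Z ∈ W, B Y₁ Z = 0) (hY₂ : Y₂ ∈ W) :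
    deformedForm B V W lam (X₁ + X₂) (Y₁ + Y₂) = B X₁ Y₁ + lam * B X₂ Y₂ := by
  rw [deformedForm_apply, deformOp_add hB hVW hX₁ hX₂ hX₂']
  simp [hX₁ _ hY₂, hsymm X₂ Y₁, hY₁ _ hX₂]

theorem deformedForm_add_add_add (hB : IsPosDef B) (hsymm : ∀ X Y, B X Y = B Y X) (hVW : V ≤ W)
    {Z Z' : E} (hX₁ : ∀ Z ∈ W, B X₁ Z = 0) (hX₂ : X₂ ∈ W) (hX₂' : ∀ Z ∈ V, B X₂ Z = 0)
    (hZ : Z ∈ V) (hY₁ : ∀ Z ∈ W, B Y₁ Z = 0) (hY₂ : Y₂ ∈ W) (hZ' : Z' ∈ V) :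
    deformedForm B V W lam (X₁ + X₂ + Z) (Y₁ + Y₂ + Z') = B X₁ Y₁ + lam * B X₂ Y₂ := by
  simp only [map_add (deformedForm B V W lam) _ Z, map_add _ (Y₁ + Y₂) Z', _root_.add_apply,
    deformedForm_symm hB hsymm _ Z', deformedForm_eq_zero_of_mem_left hB hVW hZ,
    deformedForm_eq_zero_of_mem_left hB hVW hZ',
    deformedForm_add_add hB hsymm hVW hX₁ hX₂ hX₂' hY₁ hY₂, add_zero]

theorem deformedForm_pos (hB : IsPosDef B) (hsymm : ∀ X Y, B X Y = B Y X) (hVW : V ≤ W)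
    (hlam : 0 < lam) (hX : X ∉ V) : 0 < deformedForm B V W lam X X := by
  obtain ⟨X₁, X₂, Z, hX₁, ⟨hX₂, hX₂'⟩, hZ, rfl⟩ := exists_eq_add_add hB hVW X
  have hnonneg : ∀ Y, 0 ≤ B Y Y := fun Y => by
    rcases eq_or_ne Y 0 with rfl | hY
    · simp
    · exact (hB Y hY).le
  rw [deformedForm_add_add_add hB hsymm hVW hX₁ hX₂ hX₂' hZ hX₁ hX₂ hZ]
  rcases eq_or_ne X₁ 0 with rfl | h₁
  · have h₂ : X₂ ≠ 0 := by
      rintro rfl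
      exact hX (by simpa using hZ)
    simpa using mul_pos hlam (hB X₂ h₂)
  · exact add_pos_of_pos_of_nonneg (hB X₁ h₁) (mul_nonneg hlam.le (hnonneg X₂))

end Deformation

section MetricInCharts

variable {E : Type*} [NormedAddCommGroup E] [NormedSpace ℝ E]
  {M : Type*} [TopologicalSpace M] [ChartedSpace E M] [IsManifold 𝓘(ℝ, E) ∞ M]

theorem inCoordinates_bilin_section
    (m : ∀ q : M, TangentSpace 𝓘(ℝ, E) q →L[ℝ] TangentSpace 𝓘(ℝ, E) q →L[ℝ] ℝ) {q₀ q : M}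
    (hq : q ∈ (chartAt E q₀).source) :
    ContinuousLinearMap.inCoordinates E (TangentSpace 𝓘(ℝ, E) : M → Type _) (E →L[ℝ] ℝ)
      (fun q : M => TangentSpace 𝓘(ℝ, E) q →L[ℝ] ℝ) q₀ q q₀ q (m q)
      = pullForm (F := E) (m q : E →L[ℝ] E →L[ℝ] ℝ)
        (mderiv E E (extChartAt 𝓘(ℝ, E) q₀).symm (extChartAt 𝓘(ℝ, E) q₀ q)) := by
  have e := TangentBundle.symmL_trivializationAt (I := 𝓘(ℝ, E)) hq
  have e' : ∀ u : E, (trivializationAt E (TangentSpace 𝓘(ℝ, E)) q₀).symm q u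
      = mderiv E E (extChartAt 𝓘(ℝ, E) q₀).symm (extChartAt 𝓘(ℝ, E) q₀ q) u := by
    intro u
    refine Eq.trans ?_ ((DFunLike.congr_fun e u).trans ?_)
    · exact (Bundle.Trivialization.symmL_apply _ (by simpa using hq) u).symm
    simp only [mderiv, modelWithCornersSelf_coe, Set.range_id, mfderivWithin_univ]
    rfl
  ext u v
  refine (inCoordinates_apply_eq₂ (E₃ := Bundle.Trivial M ℝ) (by simpa using hq) (by simpa using hq)
    (Set.mem_univ _)).trans ?_
  have ht : ∀ r : ℝ, (trivializationAt ℝ (Bundle.Trivial M ℝ) q₀).linearMapAt ℝ q r = r := by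
    intro r
    simp
  refine (ht _).trans ?_
  exact congrArg₂ (fun a b : E => (m q : E →L[ℝ] E →L[ℝ] ℝ) a b) (e' u) (e' v)

theorem contMDiffAt_bilin_section_iff
    (m : ∀ q : M, TangentSpace 𝓘(ℝ, E) q →L[ℝ] TangentSpace 𝓘(ℝ, E) q →L[ℝ] ℝ) (q₀ : M) :
    ContMDiffAt 𝓘(ℝ, E) (𝓘(ℝ, E).prod 𝓘(ℝ, E →L[ℝ] E →L[ℝ] ℝ)) ∞
      (fun q : M => Bundle.TotalSpace.mk' (E →L[ℝ] E →L[ℝ] ℝ) q (m q)) q₀ ↔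
    ContMDiffAt 𝓘(ℝ, E) 𝓘(ℝ, E →L[ℝ] E →L[ℝ] ℝ) ∞
      (fun q => pullForm (F := E) (m q : E →L[ℝ] E →L[ℝ] ℝ)
        (mderiv E E (extChartAt 𝓘(ℝ, E) q₀).symm (extChartAt 𝓘(ℝ, E) q₀ q))) q₀ := by
  refine (contMDiffAt_hom_bundle _).trans ?_
  have hev : ∀ᶠ q in 𝓝 q₀, q ∈ (chartAt E q₀).source :=
    (chartAt E q₀).open_source.mem_nhds (mem_chart_source E q₀)
  constructor
  · intro h
    refine h.2.congr_of_eventuallyEq ?_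
    exact hev.mono fun q hq => (inCoordinates_bilin_section m hq).symm
  · intro h
    refine ⟨contMDiffAt_id, ?_⟩
    refine h.congr_of_eventuallyEq ?_
    exact hev.mono fun q hq => inCoordinates_bilin_section m hq

variable (g : SmoothMetric E M) (p : M)

/-- The inner product of the metric at a point, as a bilinear form on the model space. Like
`mderiv`, it forgets the base point of the tangent space. -/
def metForm (q : M) : E →L[ℝ] E →L[ℝ] ℝ := g.inner q

theorem metForm_symm (q : M) (u v : E) : metForm g q u v = metForm g q v u := g.symm q u v

theorem isPosDef_metForm (q : M) : IsPosDef (metForm g q) := g.pos q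

/-- The metric in the preferred chart around `p`, as a function with values in bilinear forms. -/
def chartForm (x : E) : E →L[ℝ] E →L[ℝ] ℝ :=
  pullForm (metForm g ((extChartAt 𝓘(ℝ, E) p).symm x))
    (mderiv E E (extChartAt 𝓘(ℝ, E) p).symm x)

theorem chartMetric_eq (x u v : E) : chartMetric g p x u v = chartForm g p x u v := rfl

theorem chartForm_symm (x u v : E) : chartForm g p x u v = chartForm g p x v u :=
  metForm_symm _ _ _ _

variable {p}

theorem isPosDef_chartForm {x : E} (hx : x ∈ (extChartAt 𝓘(ℝ, E) p).target) :
    IsPosDef (chartForm g p x) :=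
  (isPosDef_metForm g _).pullForm (Function.LeftInverse.injective
    fun u => DFunLike.congr_fun (mderiv_extChartAt_comp_symm hx) u)

theorem chartForm_extChart {q : M} (hq : q ∈ (chartAt E p).source) (u v : E) :
    chartForm g p (extChartAt 𝓘(ℝ, E) p q) (mderiv E E (extChartAt 𝓘(ℝ, E) p) q u)
      (mderiv E E (extChartAt 𝓘(ℝ, E) p) q v) = metForm g q u v := by
  have h := mderiv_extChartAt_symm_comp hq
  have hu := DFunLike.congr_fun h u
  have hv := DFunLike.congr_fun h v
  have hl : (extChartAt 𝓘(ℝ, E) p).symm (extChartAt 𝓘(ℝ, E) p q) = q :=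
    (extChartAt 𝓘(ℝ, E) p).left_inv (by simpa using hq)
  simp only [ContinuousLinearMap.comp_apply, ContinuousLinearMap.id_apply] at hu hv
  rw [chartForm, pullForm_apply, hu, hv, hl]

theorem contDiffAt_chartForm_self :
    ContDiffAt ℝ ∞ (chartForm g p) (extChartAt 𝓘(ℝ, E) p p) := by
  have h := (contMDiffAt_bilin_section_iff g.inner p).1 g.contMDiff.contMDiffAt
  rw [← contMDiffAt_iff_contDiffAt]
  have hm := mem_extChartAt_target (I := 𝓘(ℝ, E)) p
  have h2 := ContMDiffAt.comp_of_eq (x := extChartAt 𝓘(ℝ, E) p p) h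
    (contMDiffAt_extChartAt_symm hm) (extChartAt_to_inv p)
  refine h2.congr_of_eventuallyEq ?_
  filter_upwards [(isOpen_extChartAt_target p).mem_nhds hm] with x hx
  simp only [Function.comp_apply, (extChartAt 𝓘(ℝ, E) p).right_inv hx]
  rfl

theorem contDiffAt_chartForm {x : E} (hx : x ∈ (extChartAt 𝓘(ℝ, E) p).target) :
    ContDiffAt ℝ ∞ (chartForm g p) x := by
  set q := (extChartAt 𝓘(ℝ, E) p).symm x
  have hsymm := contMDiffAt_extChartAt_symm hx
  set ψ : E → E := fun y => extChartAt 𝓘(ℝ, E) q ((extChartAt 𝓘(ℝ, E) p).symm y) with hψ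
  have hψs : ContDiffAt ℝ ∞ ψ x := by
    rw [← contMDiffAt_iff_contDiffAt]
    exact ContMDiffAt.comp_of_eq (contMDiffAt_extChartAt' (mem_chart_source E q)) hsymm rfl
  have hd : ContDiffAt ℝ ∞ (fderiv ℝ ψ) x := hψs.fderiv_right (by simp)
  have hc := (contDiffAt_chartForm_self g (p := q)).comp x hψs
  refine (contDiff_pullForm.contDiffAt.comp x (hc.prodMk hd)).congr_of_eventuallyEq ?_
  filter_upwards [(isOpen_extChartAt_target p).mem_nhds hx,
    hsymm.continuousAt.preimage_mem_nhds
      ((chartAt E q).open_source.mem_nhds (mem_chart_source E q))] with y hy hyq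
  ext u v
  have hy' : (extChartAt 𝓘(ℝ, E) p).symm y ∈ (chartAt E q).source := hyq
  simp only [Function.comp_apply, pullForm_apply]
  rw [← mderiv_eq_fderiv, hψ, mderiv_comp (mdifferentiableAt_extChartAt hy')
    (mdifferentiableAt_extChartAt_symm hy) rfl]
  exact (chartForm_extChart g hy' _ _).symm

end MetricInCharts

section GeodesicEquation

variable {E : Type*} [NormedAddCommGroup E] [NormedSpace ℝ E]
  {h : E → E →L[ℝ] E →L[ℝ] ℝ} {c d : ℝ → E} {t : ℝ}

/-- The Christoffel symbols of the first kind of a metric `h` on an open subset of `E`, contracted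
twice with `v`: the functional `w ↦ D_v h (v, w) - ½ D_w h (v, v)`. -/
def christoffelForm (h : E → E →L[ℝ] E →L[ℝ] ℝ) (x v : E) : E →L[ℝ] ℝ :=
  fderiv ℝ h x v v - (1 / 2 : ℝ) • ((fderiv ℝ h x).flip v).flip v

/-- The covariant acceleration `∇_{c'} c'` of a curve for a metric `h` on an open subset of `E`,
with its index lowered by `h`. -/
def covariantAccel (h : E → E →L[ℝ] E →L[ℝ] ℝ) (c : ℝ → E) (t : ℝ) : E →L[ℝ] ℝ :=
  h (c t) (deriv (deriv c) t) + christoffelForm h (c t) (deriv c t)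

theorem covariantAccel_apply (w : E) : covariantAccel h c t w = h (c t) (deriv (deriv c) t) w
    + (fderiv ℝ h (c t) (deriv c t) (deriv c t) w
      - (1 / 2) * fderiv ℝ h (c t) w (deriv c t) (deriv c t)) := rfl

section FirstVariation

theorem hasDerivAt_form_fderiv {X : Type*} [NormedAddCommGroup X] [NormedSpace ℝ X] {c : X → E}
    {l : ℝ → X} {e : X} (hl : HasDerivAt l e t) (hh : DifferentiableAt ℝ h (c (l t)))
    (hc : ContDiffAt ℝ 2 c (l t)) (u v : X) :
    HasDerivAt (fun s => h (c (l s)) (fderiv ℝ c (l s) u) (fderiv ℝ c (l s) v))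
      (fderiv ℝ h (c (l t)) (fderiv ℝ c (l t) e) (fderiv ℝ c (l t) u) (fderiv ℝ c (l t) v)
        + h (c (l t)) (fderiv ℝ (fderiv ℝ c) (l t) e u) (fderiv ℝ c (l t) v)
        + h (c (l t)) (fderiv ℝ c (l t) u) (fderiv ℝ (fderiv ℝ c) (l t) e v)) t := by
  have hcl : HasDerivAt (fun s => c (l s)) (fderiv ℝ c (l t) e) t :=
    (hc.differentiableAt (by simp)).hasFDerivAt.comp_hasDerivAt t hl
  have hdcl : HasDerivAt (fun s => fderiv ℝ c (l s)) (fderiv ℝ (fderiv ℝ c) (l t) e) t :=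
    ((hc.fderiv_right (m := 1) (by norm_num)).differentiableAt
      (by simp)).hasFDerivAt.comp_hasDerivAt t hl
  have hhl : HasDerivAt (fun s => h (c (l s))) (fderiv ℝ h (c (l t)) (fderiv ℝ c (l t) e)) t :=
    HasFDerivAt.comp_hasDerivAt (l := h) (f := fun s => c (l s)) t hh.hasFDerivAt hcl
  convert! (hhl.clm_apply (hdcl.clm_apply (hasDerivAt_const t u))).clm_apply
    (hdcl.clm_apply (hasDerivAt_const t v)) using 1
  simp

theorem deriv_deriv_comp_line {X : Type*} [NormedAddCommGroup X] [NormedSpace ℝ X] {c : X → E}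
    {l : ℝ → X} {e : X} (hl : ∀ s, HasDerivAt l e s) (hc : ContDiffAt ℝ 2 c (l t)) :
    deriv (deriv fun s => c (l s)) t = fderiv ℝ (fderiv ℝ c) (l t) e e := by
  have hcd : ∀ᶠ x in 𝓝 (l t), DifferentiableAt ℝ c x :=
    (hc.eventually (by simp)).mono fun x hx => hx.differentiableAt (by simp)
  have hderiv : deriv (fun s => c (l s)) =ᶠ[𝓝 t] fun s => fderiv ℝ c (l s) e := by
    filter_upwards [(hl t).continuousAt.eventually hcd] with s hs
    exact (hs.hasFDerivAt.comp_hasDerivAt s (hl s)).deriv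
  have hdc : DifferentiableAt ℝ (fderiv ℝ c) (l t) :=
    (hc.fderiv_right (m := 1) (by norm_num)).differentiableAt (by simp)
  rw [hderiv.deriv_eq]
  simpa using ((hdc.hasFDerivAt.comp_hasDerivAt t (hl t)).clm_apply (hasDerivAt_const t e)).deriv

theorem hasDerivAt_prodMk_left (s t : ℝ) : HasDerivAt (fun s : ℝ => (s, t)) ((1 : ℝ), (0 : ℝ)) s :=
  (hasDerivAt_id s).prodMk (hasDerivAt_const s t)

theorem hasDerivAt_prodMk_right (s t : ℝ) : HasDerivAt (fun t : ℝ => (s, t)) ((0 : ℝ), (1 : ℝ)) t :=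
  (hasDerivAt_const t s).prodMk (hasDerivAt_id t)

/- If `S` and `T` are the partial derivatives of the variation, then `∇_S h(T, T) = 0` and
`∇_T h(T, S) = 0`, while `∇_S T = ∇_T S`; hence `h(∇_T T, S) = ½ ∇_S h(T, T) = 0`. -/
theorem covariantAccel_variation_eq_zero {c : ℝ × ℝ → E} (hsymm : ∀ x u v, h x u v = h x v u)
    (hh : DifferentiableAt ℝ h (c (0, t))) (hc : ContDiffAt ℝ 2 c (0, t))
    (hspeed : ∀ᶠ s in 𝓝 (0 : ℝ),
      h (c (s, t)) (fderiv ℝ c (s, t) (0, 1)) (fderiv ℝ c (s, t) (0, 1))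
        = h (c (0, t)) (fderiv ℝ c (0, t) (0, 1)) (fderiv ℝ c (0, t) (0, 1)))
    (hmom : ∀ᶠ s in 𝓝 t, h (c (0, s)) (fderiv ℝ c (0, s) (0, 1)) (fderiv ℝ c (0, s) (1, 0))
      = h (c (0, t)) (fderiv ℝ c (0, t) (0, 1)) (fderiv ℝ c (0, t) (1, 0))) :
    covariantAccel h (fun s => c (0, s)) t (fderiv ℝ c (0, t) (1, 0)) = 0 := by
  have hsymm₂ : fderiv ℝ (fderiv ℝ c) (0, t) (1, 0) (0, 1)
      = fderiv ℝ (fderiv ℝ c) (0, t) (0, 1) (1, 0) :=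
    hc.isSymmSndFDerivAt (by simp) (1, 0) (0, 1)
  have hvel : deriv (fun s => c (0, s)) t = fderiv ℝ c (0, t) (0, 1) :=
    ((hc.differentiableAt (by simp)).hasFDerivAt.comp_hasDerivAt t
      (hasDerivAt_prodMk_right 0 t)).deriv
  have hacc : deriv (deriv fun s => c (0, s)) t = fderiv ℝ (fderiv ℝ c) (0, t) (0, 1) (0, 1) :=
    deriv_deriv_comp_line (fun s => hasDerivAt_prodMk_right 0 s) hc
  have hspeed' := (hasDerivAt_form_fderiv (hasDerivAt_prodMk_left 0 t) hh hc (0, 1) (0, 1)).unique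
    ((hasDerivAt_const (0 : ℝ) _).congr_of_eventuallyEq hspeed)
  have hmom' := (hasDerivAt_form_fderiv (hasDerivAt_prodMk_right 0 t) hh hc (0, 1) (1, 0)).unique
    ((hasDerivAt_const t _).congr_of_eventuallyEq hmom)
  rw [hsymm _ (fderiv ℝ (fderiv ℝ c) (0, t) (1, 0) (0, 1)), hsymm₂] at hspeed'
  rw [covariantAccel_apply, hvel, hacc]
  linarith

end FirstVariation

section GeodesicSpray

/-- The geodesic spray of the metric `h`: the vector field on phase space `E × E` whose integral
curves are the pairs `(c, c')` with `c` a geodesic. -/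
def geodesicSpray (h : E → E →L[ℝ] E →L[ℝ] ℝ) (p : E × E) : E × E :=
  (p.2, -(h p.1).inverse (christoffelForm h p.1 p.2))

set_option maxSynthPendingDepth 3 in
theorem contDiffAt_christoffelForm {p : E × E} (hh : ContDiffAt ℝ 2 h p.1) :
    ContDiffAt ℝ 1 (fun p : E × E => christoffelForm h p.1 p.2) p := by
  have hdh : ContDiffAt ℝ 1 (fun p : E × E => fderiv ℝ h p.1) p :=
    ContDiffAt.comp (g := fderiv ℝ h) p (hh.fderiv_right (m := 1) (by norm_num)) contDiffAt_fst
  have hflip := contDiff_flip.contDiffAt.comp p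
    ((contDiff_flip.contDiffAt.comp p hdh).clm_apply contDiffAt_snd)
  exact ((hdh.clm_apply contDiffAt_snd).clm_apply contDiffAt_snd).sub
    ((hflip.clm_apply contDiffAt_snd).const_smul (1 / 2 : ℝ))

theorem differentiableAt_deriv_of_contDiffAt (hc : ContDiffAt ℝ 2 c t) :
    DifferentiableAt ℝ (deriv c) t :=
  (((hc.fderiv_right (m := 1) (by norm_num)).clm_apply contDiffAt_const).congr_of_eventuallyEq
    (.of_forall fun s => fderiv_apply_one_eq_deriv.symm)).differentiableAt (by simp)

theorem hasDerivAt_phaseCurve (hc : ContDiffAt ℝ 2 c t) (hinv : (h (c t)).IsInvertible)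
    (hgeod : covariantAccel h c t = 0) :
    HasDerivAt (fun s => (c s, deriv c s)) (geodesicSpray h (c t, deriv c t)) t := by
  have hacc : -(h (c t)).inverse (christoffelForm h (c t) (deriv c t)) = deriv (deriv c) t := by
    rw [← map_neg, ← eq_neg_of_add_eq_zero_left hgeod]
    exact hinv.inverse_apply_self _
  rw [geodesicSpray, hacc]
  exact (hc.differentiableAt (by simp)).hasDerivAt.prodMk
    (differentiableAt_deriv_of_contDiffAt hc).hasDerivAt

variable [CompleteSpace E]

theorem contDiffAt_geodesicSpray {p : E × E} (hh : ContDiffAt ℝ 2 h p.1)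
    (hinv : (h p.1).IsInvertible) : ContDiffAt ℝ 1 (geodesicSpray h) p := by
  have hinverse : ContDiffAt ℝ 1 (fun p : E × E => (h p.1).inverse) p :=
    ContDiffAt.comp (g := ContinuousLinearMap.inverse) (f := fun p : E × E => h p.1) p
      hinv.contDiffAt_map_inverse
      (ContDiffAt.comp (g := h) (f := Prod.fst) p (hh.of_le (by norm_num)) contDiffAt_fst)
  exact contDiffAt_snd.prodMk (hinverse.clm_apply (contDiffAt_christoffelForm hh)).neg

theorem eventuallyEq_of_covariantAccel_eq_zero (hh : ContDiffAt ℝ 2 h (c t))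
    (hinv : ∀ᶠ x in 𝓝 (c t), (h x).IsInvertible) (hc : ContDiffAt ℝ 2 c t)
    (hd : ContDiffAt ℝ 2 d t) (hcg : ∀ᶠ s in 𝓝 t, covariantAccel h c s = 0)
    (hdg : ∀ᶠ s in 𝓝 t, covariantAccel h d s = 0) (h₀ : c t = d t)
    (h₁ : deriv c t = deriv d t) : c =ᶠ[𝓝 t] d := by
  obtain ⟨K, U, hU, hL⟩ := (contDiffAt_geodesicSpray (p := (c t, deriv c t)) hh
    hinv.self_of_nhds).exists_lipschitzOnWith
  have phaseCurve : ∀ e : ℝ → E, ContDiffAt ℝ 2 e t → e t = c t → deriv e t = deriv c t →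
      (∀ᶠ s in 𝓝 t, covariantAccel h e s = 0) → ∀ᶠ s in 𝓝 t,
        HasDerivAt (fun s => (e s, deriv e s)) (geodesicSpray h (e s, deriv e s)) s ∧
          (e s, deriv e s) ∈ U := by
    intro e he e₀ e₁ heg
    have hcont : ContinuousAt (fun s => (e s, deriv e s)) t :=
      he.continuousAt.prodMk (differentiableAt_deriv_of_contDiffAt he).continuousAt
    filter_upwards [heg, he.eventually (by simp),
      hcont.preimage_mem_nhds (by rwa [e₀, e₁]),
      he.continuousAt.eventually (by rwa [e₀])] with s hgeod hs hsU hsinv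
    exact ⟨hasDerivAt_phaseCurve hs hsinv hgeod, hsU⟩
  have hphase := ODE_solution_unique_of_eventually (v := fun _ => geodesicSpray h)
    (s := fun _ => U) (K := K) (Filter.Eventually.of_forall fun _ => hL)
    (phaseCurve c hc rfl rfl hcg) (phaseCurve d hd h₀.symm h₁.symm hdg) (by simp [h₀, h₁])
  exact hphase.mono fun s hs => congrArg Prod.fst hs

end GeodesicSpray

end GeodesicEquation

section Geodesics

variable {E : Type*} [NormedAddCommGroup E] [NormedSpace ℝ E]
  {M : Type*} [TopologicalSpace M] [ChartedSpace E M] [IsManifold 𝓘(ℝ, E) ∞ M]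
  {g : SmoothMetric E M} {γ γ₁ γ₂ : ℝ → M} {J : Set ℝ} {t : ℝ} {p : M}

theorem chartChristoffel_eq {x : E} (hx : x ∈ (extChartAt 𝓘(ℝ, E) p).target) (u w : E) :
    chartChristoffel g p x u w = christoffelForm (chartForm g p) x u w := by
  have hd : DifferentiableAt ℝ (chartForm g p) x :=
    (contDiffAt_chartForm g hx).differentiableAt (by simp)
  have hfderiv : ∀ a b c : E, fderiv ℝ (fun y => chartMetric g p y a b) x c
      = fderiv ℝ (chartForm g p) x c a b := by
    intro a b c
    have h := ((hd.hasFDerivAt.clm_apply (hasFDerivAt_const a x)).clm_apply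
      (hasFDerivAt_const b x)).fderiv
    simp only [chartMetric_eq, h]
    simp
  rw [chartChristoffel, hfderiv, hfderiv]
  rfl

theorem isGeodesicOn_iff : IsGeodesicOn g γ J ↔ ContMDiffOn 𝓘(ℝ, ℝ) 𝓘(ℝ, E) ∞ γ J ∧
    ∀ t ∈ J, ∀ p : M, γ t ∈ (chartAt E p).source →
      covariantAccel (chartForm g p) (fun s => extChartAt 𝓘(ℝ, E) p (γ s)) t = 0 := by
  refine and_congr_right fun _ => forall₄_congr fun t _ p hp => ?_
  have hx := (extChartAt 𝓘(ℝ, E) p).map_source (x := γ t) (by simpa using hp)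
  simp only [ContinuousLinearMap.ext_iff, chartMetric_eq, chartChristoffel_eq hx]
  rfl

theorem mderiv_extChartAt_velocity {X : Type*} [NormedAddCommGroup X] [NormedSpace ℝ X]
    {σ : X → M} {l : ℝ → X} {e : X} (hl : HasDerivAt l e t)
    (hσ : MDifferentiableAt 𝓘(ℝ, X) 𝓘(ℝ, E) σ (l t)) (hp : σ (l t) ∈ (chartAt E p).source) :
    mderiv E E (extChartAt 𝓘(ℝ, E) p) (σ (l t)) (velocity E (fun s => σ (l s)) t)
      = fderiv ℝ (fun x => extChartAt 𝓘(ℝ, E) p (σ x)) (l t) e := by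
  rw [velocity_comp hσ hl.differentiableAt.mdifferentiableAt rfl, velocity_eq_deriv, hl.deriv,
    ← mderiv_eq_fderiv, mderiv_comp (mdifferentiableAt_extChartAt hp) hσ rfl]
  rfl

theorem covariantAccel_chartForm_variation_eq_zero {σ : ℝ × ℝ → M}
    (hσ : ContMDiff 𝓘(ℝ, ℝ × ℝ) 𝓘(ℝ, E) ∞ σ) (hp : σ (0, t) ∈ (chartAt E p).source)
    (hspeed : ∀ s, metForm g (σ (s, t)) (velocity E (fun r => σ (s, r)) t)
        (velocity E (fun r => σ (s, r)) t)
      = metForm g (σ (0, t)) (velocity E (fun r => σ (0, r)) t) (velocity E (fun r => σ (0, r)) t))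
    (hmom : ∀ t', metForm g (σ (0, t')) (velocity E (fun r => σ (0, r)) t')
        (velocity E (fun s => σ (s, t')) 0)
      = metForm g (σ (0, t)) (velocity E (fun r => σ (0, r)) t)
        (velocity E (fun s => σ (s, t)) 0)) :
    covariantAccel (chartForm g p) (fun r => extChartAt 𝓘(ℝ, E) p (σ (0, r))) t
      (mderiv E E (extChartAt 𝓘(ℝ, E) p) (σ (0, t)) (velocity E (fun s => σ (s, t)) 0)) = 0 := by
  have hσd : ∀ x, MDifferentiableAt 𝓘(ℝ, ℝ × ℝ) 𝓘(ℝ, E) σ x := fun x =>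
    hσ.mdifferentiableAt (by simp)
  have hsource : ∀ᶠ x in 𝓝 ((0 : ℝ), t), σ x ∈ (chartAt E p).source :=
    hσ.continuous.continuousAt ((chartAt E p).open_source.mem_nhds hp)
  have hleft := fun s t => mderiv_extChartAt_velocity (p := p) (hasDerivAt_prodMk_left s t)
    (hσd (s, t))
  have hright := fun s t => mderiv_extChartAt_velocity (p := p) (hasDerivAt_prodMk_right s t)
    (hσd (s, t))
  rw [hleft 0 t hp]
  refine covariantAccel_variation_eq_zero (c := fun x => extChartAt 𝓘(ℝ, E) p (σ x))
    (chartForm_symm g p) ?_ ?_ ?_ ?_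
  · exact (contDiffAt_chartForm g ((extChartAt 𝓘(ℝ, E) p).map_source
      (by simpa using hp))).differentiableAt (by simp)
  · rw [← contMDiffAt_iff_contDiffAt]
    exact (ContMDiffAt.comp_of_eq (contMDiffAt_extChartAt' hp) (hσ (0, t)) rfl).of_le (by norm_cast)
  · filter_upwards [(hasDerivAt_prodMk_left 0 t).continuousAt.eventually hsource] with s hs
    rw [← hright s t hs, ← hright 0 t hp, chartForm_extChart g hs, chartForm_extChart g hp, hspeed]
  · filter_upwards [(hasDerivAt_prodMk_right 0 t).continuousAt.eventually hsource] with t' ht'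
    rw [← hright 0 t' ht', ← hright 0 t hp, ← hleft 0 t' ht', ← hleft 0 t hp,
      chartForm_extChart g ht', chartForm_extChart g hp, hmom]

theorem contDiffAt_extChartAt_comp (hγ : ContMDiffAt 𝓘(ℝ, ℝ) 𝓘(ℝ, E) ∞ γ t)
    (hp : γ t ∈ (chartAt E p).source) :
    ContDiffAt ℝ ∞ (fun s => extChartAt 𝓘(ℝ, E) p (γ s)) t :=
  contMDiffAt_iff_contDiffAt.1 (ContMDiffAt.comp_of_eq (contMDiffAt_extChartAt' hp) hγ rfl)

theorem deriv_extChartAt_comp_self (hγ : MDifferentiableAt 𝓘(ℝ, ℝ) 𝓘(ℝ, E) γ t) (hp : γ t = p) :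
    deriv (fun s => extChartAt 𝓘(ℝ, E) p (γ s)) t = velocity E γ t := by
  rw [← velocity_eq_deriv,
    velocity_comp (mdifferentiableAt_extChartAt (mem_chart_source E p)) hγ hp,
    mderiv_extChartAt_self, ContinuousLinearMap.id_apply]

theorem velocity_eq_of_frequently_eventuallyEq [T2Space M]
    (h₁ : ContMDiffAt 𝓘(ℝ, ℝ) 𝓘(ℝ, E) ∞ γ₁ t) (h₂ : ContMDiffAt 𝓘(ℝ, ℝ) 𝓘(ℝ, E) ∞ γ₂ t)
    (h : ∃ᶠ s in 𝓝 t, γ₁ =ᶠ[𝓝 s] γ₂) : γ₁ t = γ₂ t ∧ velocity E γ₁ t = velocity E γ₂ t := by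
  have hpos : γ₁ t = γ₂ t := tendsto_nhds_unique_of_frequently_eq h₁.continuousAt h₂.continuousAt
    (h.mono fun s hs => hs.self_of_nhds)
  refine ⟨hpos, ?_⟩
  rw [← deriv_extChartAt_comp_self (p := γ₂ t) (h₁.mdifferentiableAt (by simp)) hpos,
    ← deriv_extChartAt_comp_self (p := γ₂ t) (h₂.mdifferentiableAt (by simp)) rfl]
  refine tendsto_nhds_unique_of_frequently_eq
    (differentiableAt_deriv_of_contDiffAt ((contDiffAt_extChartAt_comp h₁
      (hpos ▸ mem_chart_source E _)).of_le (by norm_cast))).continuousAt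
    (differentiableAt_deriv_of_contDiffAt ((contDiffAt_extChartAt_comp h₂
      (mem_chart_source E _)).of_le (by norm_cast))).continuousAt
    (h.mono fun s hs => (hs.fun_comp (extChartAt 𝓘(ℝ, E) (γ₂ t))).deriv_eq)

theorem IsGeodesicOn.mono {J' : Set ℝ} (h : IsGeodesicOn g γ J) (hJ : J' ⊆ J) :
    IsGeodesicOn g γ J' :=
  ⟨h.1.mono hJ, fun t ht => h.2 t (hJ ht)⟩

theorem IsGeodesicOn.contMDiffAt (h : IsGeodesicOn g γ J) (hJ : IsOpen J) (ht : t ∈ J) :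
    ContMDiffAt 𝓘(ℝ, ℝ) 𝓘(ℝ, E) ∞ γ t :=
  h.1.contMDiffAt (hJ.mem_nhds ht)

theorem IsGeodesicOn.eventually_covariantAccel_eq_zero (h : IsGeodesicOn g γ J) (hJ : IsOpen J)
    (ht : t ∈ J) (hp : γ t ∈ (chartAt E p).source) :
    ∀ᶠ s in 𝓝 t, covariantAccel (chartForm g p) (fun s => extChartAt 𝓘(ℝ, E) p (γ s)) s = 0 := by
  filter_upwards [hJ.mem_nhds ht, (h.contMDiffAt hJ ht).continuousAt.preimage_mem_nhds
    ((chartAt E p).open_source.mem_nhds hp)] with s hs hsp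
  exact (isGeodesicOn_iff.1 h).2 s hs p hsp

variable [FiniteDimensional ℝ E]

theorem IsGeodesicOn.eventuallyEq (h₁ : IsGeodesicOn g γ₁ J) (h₂ : IsGeodesicOn g γ₂ J)
    (hJ : IsOpen J) (ht : t ∈ J) (h₀ : γ₁ t = γ₂ t) (hv : velocity E γ₁ t = velocity E γ₂ t) :
    γ₁ =ᶠ[𝓝 t] γ₂ := by
  have hγ₁ := h₁.contMDiffAt hJ ht
  have hγ₂ := h₂.contMDiffAt hJ ht
  obtain ⟨p, hp⟩ : ∃ p, γ₂ t = p := ⟨_, rfl⟩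
  have hp₂ : γ₂ t ∈ (chartAt E p).source := hp ▸ mem_chart_source E p
  have hp₁ : γ₁ t ∈ (chartAt E p).source := h₀ ▸ hp₂
  have hx : extChartAt 𝓘(ℝ, E) p (γ₁ t) ∈ (extChartAt 𝓘(ℝ, E) p).target :=
    (extChartAt 𝓘(ℝ, E) p).map_source (by simpa using hp₁)
  have hcoord : (fun s => extChartAt 𝓘(ℝ, E) p (γ₁ s))
      =ᶠ[𝓝 t] fun s => extChartAt 𝓘(ℝ, E) p (γ₂ s) := by
    refine eventuallyEq_of_covariantAccel_eq_zero
      ((contDiffAt_chartForm g hx).of_le (by norm_cast)) ?_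
      ((contDiffAt_extChartAt_comp hγ₁ hp₁).of_le (by norm_cast))
      ((contDiffAt_extChartAt_comp hγ₂ hp₂).of_le (by norm_cast))
      (h₁.eventually_covariantAccel_eq_zero hJ ht hp₁)
      (h₂.eventually_covariantAccel_eq_zero hJ ht hp₂) (congrArg _ h₀) ?_
    · filter_upwards [(isOpen_extChartAt_target p).mem_nhds hx] with x hx
      exact (isPosDef_chartForm g hx).isInvertible
    · rw [deriv_extChartAt_comp_self (hγ₁.mdifferentiableAt (by simp)) (h₀.trans hp), hv,
        deriv_extChartAt_comp_self (hγ₂.mdifferentiableAt (by simp)) hp]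
  filter_upwards [hcoord,
    hγ₁.continuousAt.preimage_mem_nhds ((chartAt E p).open_source.mem_nhds hp₁),
    hγ₂.continuousAt.preimage_mem_nhds ((chartAt E p).open_source.mem_nhds hp₂)] with s hs hs₁ hs₂
  exact (extChartAt 𝓘(ℝ, E) p).injOn (by simpa using hs₁) (by simpa using hs₂) hs

theorem IsGeodesicOn.eqOn [T2Space M] (h₁ : IsGeodesicOn g γ₁ J) (h₂ : IsGeodesicOn g γ₂ J)
    (hJ : IsOpen J) (hJc : J.OrdConnected) (ht : t ∈ J) (h₀ : γ₁ t = γ₂ t)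
    (hv : velocity E γ₁ t = velocity E γ₂ t) : Set.EqOn γ₁ γ₂ J := by
  have hsub : J ⊆ {s | γ₁ =ᶠ[𝓝 s] γ₂} := by
    refine hJc.isPreconnected.subset_of_closure_inter_subset isOpen_setOfPred_eventually_nhds
      ⟨t, ht, h₁.eventuallyEq h₂ hJ ht h₀ hv⟩ ?_
    rintro s ⟨hs, hsJ⟩
    obtain ⟨hpos, hvel⟩ := velocity_eq_of_frequently_eventuallyEq (h₁.contMDiffAt hJ hsJ)
      (h₂.contMDiffAt hJ hsJ) (mem_closure_iff_frequently.1 hs)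
    exact h₁.eventuallyEq h₂ hJ hsJ hpos hvel
  exact fun s hs => (hsub hs).self_of_nhds

end Geodesics

section SmoothIntegralCurves

variable {E : Type*} [NormedAddCommGroup E] [NormedSpace ℝ E]
  {M : Type*} [TopologicalSpace M] [ChartedSpace E M]

theorem contDiffAt_of_eventually_hasDerivAt {F : E → E} {c : ℝ → E} {t₀ : ℝ}
    (hF : ContDiffAt ℝ ∞ F (c t₀)) (hc : ∀ᶠ t in 𝓝 t₀, HasDerivAt c (F (c t)) t) :
    ContDiffAt ℝ ∞ c t₀ := by
  rw [contDiffAt_infty]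
  intro n
  have hFn : ∀ᶠ x in 𝓝 (c t₀), ContDiffAt ℝ n F x :=
    (hF.of_le (by exact_mod_cast le_top)).eventually (by simp)
  obtain ⟨U, hU, hUo, ht₀⟩ := eventually_nhds_iff.1
    (hc.and (hc.self_of_nhds.continuousAt.eventually hFn))
  have bootstrap : ∀ k : ℕ, k ≤ n → ContDiffOn ℝ k c U := by
    intro k
    induction k with
    | zero =>
      exact fun _ => contDiffOn_zero.2
        fun t ht => (hU t ht).1.continuousAt.continuousWithinAt
    | succ k ih =>
      intro hk
      have hderiv : ContDiffOn ℝ k (deriv c) U := by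
        refine ContDiffOn.congr (f := fun t => F (c t)) (fun t ht => ?_)
          fun t ht => (hU t ht).1.deriv
        exact ((hU t ht).2.of_le (by exact_mod_cast (Nat.le_of_succ_le hk))).comp_contDiffWithinAt
          t (ih (Nat.le_of_succ_le hk) t ht)
      exact_mod_cast (contDiffOn_succ_iff_deriv_of_isOpen (n := (k : WithTop ℕ∞)) hUo).2
        ⟨fun t ht => (hU t ht).1.differentiableAt.differentiableWithinAt, by simp, hderiv⟩
  exact (bootstrap n le_rfl).contDiffAt (hUo.mem_nhds ht₀)

theorem hasMFDerivAt_smulRight_iff {γ : ℝ → M} {t : ℝ} {v : TangentSpace 𝓘(ℝ, E) (γ t)} :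
    HasMFDerivAt 𝓘(ℝ, ℝ) 𝓘(ℝ, E) γ t ((1 : ℝ →L[ℝ] ℝ).smulRight v) ↔
      MDifferentiableAt 𝓘(ℝ, ℝ) 𝓘(ℝ, E) γ t ∧ velocity E γ t = v := by
  constructor
  · intro h
    exact ⟨h.mdifferentiableAt, (DFunLike.congr_fun h.mfderiv (1 : ℝ)).trans (one_smul ℝ v)⟩
  · rintro ⟨h, hv⟩
    have hγ : mfderiv 𝓘(ℝ, ℝ) 𝓘(ℝ, E) γ t = (1 : ℝ →L[ℝ] ℝ).smulRight v :=
      ContinuousLinearMap.ext_ring (hv.trans (one_smul ℝ v).symm)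
    exact hγ ▸ h.hasMFDerivAt

variable [IsManifold 𝓘(ℝ, E) ∞ M]

theorem contMDiffAt_of_eventually_velocity_eq {v : M → E} {γ : ℝ → M} {t₀ : ℝ} {p : M}
    (hv : ContMDiffAt 𝓘(ℝ, E) 𝓘(ℝ, E) ∞ (fun x => mderiv E E (extChartAt 𝓘(ℝ, E) p) x (v x)) p)
    (hp : γ t₀ = p)
    (hγ : ∀ᶠ t in 𝓝 t₀, MDifferentiableAt 𝓘(ℝ, ℝ) 𝓘(ℝ, E) γ t ∧ velocity E γ t = v (γ t)) :
    ContMDiffAt 𝓘(ℝ, ℝ) 𝓘(ℝ, E) ∞ γ t₀ := by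
  set φ := extChartAt 𝓘(ℝ, E) p
  have hmem : ∀ᶠ t in 𝓝 t₀, γ t ∈ (chartAt E p).source :=
    hγ.self_of_nhds.1.continuousAt.preimage_mem_nhds
      ((chartAt E p).open_source.mem_nhds (hp ▸ mem_chart_source E p))
  have hleft : ∀ {q}, q ∈ (chartAt E p).source → φ.symm (φ q) = q := fun hq =>
    φ.left_inv (by simpa [φ] using hq)
  have hpt : φ p ∈ φ.target := mem_extChartAt_target p
  have hF : ContDiffAt ℝ ∞ (fun x => mderiv E E φ (φ.symm x) (v (φ.symm x))) (φ (γ t₀)) := by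
    rw [hp]
    exact contMDiffAt_iff_contDiffAt.1 (ContMDiffAt.comp_of_eq hv
      (contMDiffAt_extChartAt_symm hpt) (extChartAt_to_inv p))
  have hc : ContDiffAt ℝ ∞ (fun t => φ (γ t)) t₀ := by
    refine contDiffAt_of_eventually_hasDerivAt hF ?_
    filter_upwards [hmem, hγ] with t ht hγt
    have hφ : MDifferentiableAt 𝓘(ℝ, E) 𝓘(ℝ, E) φ (γ t) := mdifferentiableAt_extChartAt ht
    have hd : DifferentiableAt ℝ (fun t => φ (γ t)) t := (hφ.comp t hγt.1).differentiableAt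
    rw [hleft ht, ← hγt.2, ← velocity_comp hφ hγt.1 rfl, velocity_eq_deriv]
    exact hd.hasDerivAt
  refine (ContMDiffAt.comp_of_eq (contMDiffAt_extChartAt_symm hpt) hc.contMDiffAt
    (by rw [hp])).congr_of_eventuallyEq ?_
  filter_upwards [hmem] with t ht
  exact (hleft ht).symm

end SmoothIntegralCurves

section LieExp

variable {E : Type*} [NormedAddCommGroup E] [NormedSpace ℝ E]
  {G : Type*} [TopologicalSpace G] [ChartedSpace E G] [Group G] [LieGroup 𝓘(ℝ, E) ∞ G]

theorem mdifferentiableAt_mul_left (a x : G) :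
    MDifferentiableAt 𝓘(ℝ, E) 𝓘(ℝ, E) (fun y : G => a * y) x :=
  (contMDiff_mul_left (I := 𝓘(ℝ, E)) (n := ∞)).mdifferentiableAt (by simp)

theorem mdifferentiableAt_mul_right (a x : G) :
    MDifferentiableAt 𝓘(ℝ, E) 𝓘(ℝ, E) (fun y : G => y * a) x :=
  (contMDiff_mul_right (I := 𝓘(ℝ, E)) (n := ∞)).mdifferentiableAt (by simp)

theorem mulInvariantVectorField_mul (X : GroupLieAlgebra 𝓘(ℝ, E) G) (a x : G) :
    (mulInvariantVectorField X (a * x) : E)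
      = mderiv E E (fun y : G => a * y) x (mulInvariantVectorField X x : E) := by
  have h := mderiv_comp (x := (1 : G)) (mdifferentiableAt_mul_left (E := E) a x)
    (mdifferentiableAt_mul_left (E := E) x 1) (mul_one x)
  simp only [← mul_assoc] at h
  exact DFunLike.congr_fun h X

theorem hasMFDerivAt_const_mul {X : GroupLieAlgebra 𝓘(ℝ, E) G} {γ : ℝ → G} (a : G) {t : ℝ}
    (h : HasMFDerivAt 𝓘(ℝ, ℝ) 𝓘(ℝ, E) γ t
      ((1 : ℝ →L[ℝ] ℝ).smulRight (mulInvariantVectorField X (γ t)))) :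
    HasMFDerivAt 𝓘(ℝ, ℝ) 𝓘(ℝ, E) (fun s => a * γ s) t
      ((1 : ℝ →L[ℝ] ℝ).smulRight (mulInvariantVectorField X (a * γ t))) := by
  rw [hasMFDerivAt_smulRight_iff] at h ⊢
  refine ⟨(mdifferentiableAt_mul_left a (γ t)).comp t h.1, ?_⟩
  rw [velocity_comp (mdifferentiableAt_mul_left a (γ t)) h.1 rfl, h.2]
  exact (mulInvariantVectorField_mul X a (γ t)).symm

theorem contMDiff_one_mulInvariantVectorField (X : GroupLieAlgebra 𝓘(ℝ, E) G) :
    ContMDiff 𝓘(ℝ, E) 𝓘(ℝ, E).tangent 1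
      (fun a : G => (⟨a, mulInvariantVectorField X a⟩ : TangentBundle 𝓘(ℝ, E) G)) := by
  have : LieGroup 𝓘(ℝ, E) (minSmoothness ℝ 3) G :=
    LieGroup.of_le (n := ∞) (by simp; norm_cast)
  exact (contMDiff_mulInvariantVectorField X).of_le (by simp)

theorem contMDiffAt_mulInvariantVectorField_inChart (X : E) (a : G) :
    ContMDiffAt 𝓘(ℝ, E) 𝓘(ℝ, E) ∞ (fun x : G => mderiv E E (extChartAt 𝓘(ℝ, E) a) x
      (mderiv E E (fun y : G => x * y) 1 X)) a := by
  have h := contMDiffAt_mderiv_inCharts (f := fun x y : G => x * y) (g := fun _ : G => (1 : G))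
    (q₀ := a) (contMDiff_mul 𝓘(ℝ, E) ∞).contMDiffAt contMDiffAt_const
  simp only [mul_one, mderiv_extChartAt_symm_self, ContinuousLinearMap.comp_id] at h
  exact h.clm_apply contMDiffAt_const

theorem t2Space_of_lieGroup (E G : Type*) [NormedAddCommGroup E] [NormedSpace ℝ E]
    [TopologicalSpace G] [ChartedSpace E G] [Group G] [LieGroup 𝓘(ℝ, E) ∞ G] : T2Space G := by
  have : T1Space G := ChartedSpace.t1Space E G
  have : IsTopologicalGroup G := topologicalGroup_of_lieGroup 𝓘(ℝ, E) ∞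
  infer_instance

theorem isMIntegralCurve_mulInvariantVectorField_unique {X : GroupLieAlgebra 𝓘(ℝ, E) G}
    {φ ψ : ℝ → G} (hφ : IsMIntegralCurve φ (mulInvariantVectorField X))
    (hψ : IsMIntegralCurve ψ (mulInvariantVectorField X)) (h : φ 0 = ψ 0) : φ = ψ := by
  have : IsManifold 𝓘(ℝ, E) 1 G := IsManifold.of_le (n := ∞) (by simp)
  have : T2Space G := t2Space_of_lieGroup E G
  exact isMIntegralCurve_Ioo_eq_of_contMDiff_boundaryless (t₀ := 0)
    (contMDiff_one_mulInvariantVectorField X) hφ hψ h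

variable [CompleteSpace E]

theorem exists_isMIntegralCurve_mulInvariantVectorField (X : GroupLieAlgebra 𝓘(ℝ, E) G) :
    ∃ φ : ℝ → G, φ 0 = 1 ∧ IsMIntegralCurve φ (mulInvariantVectorField X) := by
  have : IsManifold 𝓘(ℝ, E) 1 G := IsManifold.of_le (n := ∞) (by simp)
  have : T2Space G := t2Space_of_lieGroup E G
  obtain ⟨γ, hγ0, hγ⟩ := exists_isMIntegralCurveAt_of_contMDiffAt_boundaryless (t₀ := 0)
    (contMDiff_one_mulInvariantVectorField X (1 : G))
  obtain ⟨ε, hε, hγ⟩ := isMIntegralCurveAt_iff'.1 hγ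
  rw [Real.ball_eq_Ioo, zero_sub, zero_add] at hγ
  -- left translates of one local integral curve provide a uniform existence time
  refine exists_isMIntegralCurve_of_isMIntegralCurveOn (contMDiff_one_mulInvariantVectorField X) hε
    (fun a => ⟨fun t => a * γ t, by simp [hγ0], fun t ht => ?_⟩) 1
  exact (hasMFDerivAt_const_mul a
    ((hγ t ht).hasMFDerivAt (isOpen_Ioo.mem_nhds ht))).hasMFDerivWithinAt

theorem lieExp_eq {X : GroupLieAlgebra 𝓘(ℝ, E) G} {φ : ℝ → G} (h0 : φ 0 = 1)
    (hφ : IsMIntegralCurve φ (mulInvariantVectorField X)) : lieExp X = φ 1 := by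
  have : Nonempty (ℝ → G) := ⟨fun _ => 1⟩
  have h := Classical.epsilon_spec (exists_isMIntegralCurve_mulInvariantVectorField X)
  exact congrFun (isMIntegralCurve_mulInvariantVectorField_unique h.2 hφ (h.1.trans h0.symm)) 1

theorem lieExp_smul_eq {X : GroupLieAlgebra 𝓘(ℝ, E) G} {φ : ℝ → G} (h0 : φ 0 = 1)
    (hφ : IsMIntegralCurve φ (mulInvariantVectorField X)) (t : ℝ) : lieExp (t • X) = φ t := by
  have h := hφ.comp_mul t
  rw [← mulInvariantVectorField_smul] at h
  simpa using lieExp_eq (φ := φ ∘ (· * t)) (by simp [h0]) h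

theorem isMIntegralCurve_lieExp_smul (X : GroupLieAlgebra 𝓘(ℝ, E) G) :
    IsMIntegralCurve (fun t : ℝ => lieExp (t • X)) (mulInvariantVectorField X) := by
  obtain ⟨φ, h0, hφ⟩ := exists_isMIntegralCurve_mulInvariantVectorField X
  rwa [show (fun t : ℝ => lieExp (t • X)) = φ from funext (lieExp_smul_eq h0 hφ)]

theorem lieExp_zero_smul (X : GroupLieAlgebra 𝓘(ℝ, E) G) : lieExp ((0 : ℝ) • X) = 1 := by
  obtain ⟨φ, h0, hφ⟩ := exists_isMIntegralCurve_mulInvariantVectorField X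
  rw [lieExp_smul_eq h0 hφ, h0]

theorem lieExp_add_smul (X : GroupLieAlgebra 𝓘(ℝ, E) G) (s t : ℝ) :
    lieExp ((s + t) • X) = lieExp (s • X) * lieExp (t • X) := by
  have h1 := (isMIntegralCurve_lieExp_smul X).comp_add s
  have h2 : IsMIntegralCurve (fun t : ℝ => lieExp (s • X) * lieExp (t • X))
      (mulInvariantVectorField X) := fun t =>
    hasMFDerivAt_const_mul _ (isMIntegralCurve_lieExp_smul X t)
  have h3 := isMIntegralCurve_mulInvariantVectorField_unique h1 h2
    (by simpa using lieExp_zero_smul X)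
  simpa [add_comm] using congrFun h3 t

theorem lieExp_neg_smul (X : GroupLieAlgebra 𝓘(ℝ, E) G) (t : ℝ) :
    lieExp ((-t) • X) = (lieExp (t • X))⁻¹ := by
  rw [eq_inv_iff_mul_eq_one, ← lieExp_add_smul, neg_add_cancel, lieExp_zero_smul]

theorem velocity_lieExp_smul (X : GroupLieAlgebra 𝓘(ℝ, E) G) (t : ℝ) :
    velocity E (fun t : ℝ => lieExp (t • X)) t
      = mderiv E E (fun y : G => lieExp (t • X) * y) 1 X :=
  (hasMFDerivAt_smulRight_iff.1 (isMIntegralCurve_lieExp_smul X t)).2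

theorem velocity_lieExp_zero (X : GroupLieAlgebra 𝓘(ℝ, E) G) :
    velocity E (fun t : ℝ => lieExp (t • X)) 0 = X := by
  simp only [velocity_lieExp_smul, lieExp_zero_smul, one_mul, mderiv_id]
  rfl

theorem contMDiff_lieExp_smul (X : GroupLieAlgebra 𝓘(ℝ, E) G) :
    ContMDiff 𝓘(ℝ, ℝ) 𝓘(ℝ, E) ∞ (fun t : ℝ => lieExp (t • X)) := fun _ =>
  contMDiffAt_of_eventually_velocity_eq
    (contMDiffAt_mulInvariantVectorField_inChart (E := E) X _) rfl
    (Filter.Eventually.of_forall fun s =>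
      hasMFDerivAt_smulRight_iff.1 (isMIntegralCurve_lieExp_smul X s))

theorem mdifferentiableAt_lieExp_smul (X : GroupLieAlgebra 𝓘(ℝ, E) G) (t : ℝ) :
    MDifferentiableAt 𝓘(ℝ, ℝ) 𝓘(ℝ, E) (fun t : ℝ => lieExp (t • X)) t :=
  (contMDiff_lieExp_smul X).mdifferentiableAt (by simp)

end LieExp

section InvariantSubspaces

variable {E : Type*} [NormedAddCommGroup E] [NormedSpace ℝ E] {V : Submodule ℝ E}

theorem mem_of_hasDerivAt_of_forall_mem (hV : IsClosed (V : Set E)) {f : ℝ → E} {f' : E} {t : ℝ}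
    (hf : HasDerivAt f f' t) (hmem : ∀ s, f s ∈ V) : f' ∈ V := by
  have h := V.mkQL.hasFDerivAt.comp_hasDerivAt t hf
  have hzero : V.mkQL ∘ f = fun _ => 0 :=
    funext fun s => (Submodule.Quotient.mk_eq_zero V).2 (hmem s)
  rw [hzero] at h
  exact (Submodule.Quotient.mk_eq_zero V).1 (h.unique (hasDerivAt_const t _))

theorem mem_of_hasDerivAt_apply (hV : IsClosed (V : Set E)) {A : E →L[ℝ] E}
    (hA : ∀ Z ∈ V, A Z ∈ V) {f : ℝ → E} (hf : ∀ s, HasDerivAt f (A (f s)) s) (h0 : f 0 ∈ V)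
    (t : ℝ) : f t ∈ V := by
  -- the image of `f` in `E ⧸ V` solves the linear equation given by the map induced by `A`
  let Abar : E ⧸ V →L[ℝ] E ⧸ V :=
    V.liftQL (V.mkQL.comp A) fun Z hZ => (Submodule.Quotient.mk_eq_zero V).2 (hA Z hZ)
  have hquot : ∀ s, HasDerivAt (V.mkQL ∘ f) (Abar (V.mkQL (f s))) s := fun s =>
    V.mkQL.hasFDerivAt.comp_hasDerivAt s (hf s)
  have hzero : V.mkQL ∘ f = fun _ => 0 :=
    ODE_solution_unique_univ (v := fun _ => Abar) (s := fun _ => Set.univ) (t₀ := 0)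
      (fun _ => Abar.lipschitz.lipschitzOnWith) (fun s => ⟨hquot s, trivial⟩)
      (fun s => ⟨by simpa using hasDerivAt_const s (0 : E ⧸ V), trivial⟩)
      ((Submodule.Quotient.mk_eq_zero V).2 h0)
  exact (Submodule.Quotient.mk_eq_zero V).1 (congrFun hzero t)

end InvariantSubspaces

section Adjoint

variable (E : Type*) [NormedAddCommGroup E] [NormedSpace ℝ E]
  {G : Type*} [TopologicalSpace G] [ChartedSpace E G] [Group G]

/-- The adjoint representation `a ↦ d(y ↦ a y a⁻¹)_e` of a Lie group on its Lie algebra. -/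
def Ad (a : G) : E →L[ℝ] E := mderiv E E (fun y : G => a * y * a⁻¹) 1

theorem Ad_one : Ad E (1 : G) = ContinuousLinearMap.id ℝ E := by
  rw [Ad, ← mderiv_id (1 : G)]
  simp

variable [LieGroup 𝓘(ℝ, E) ∞ G]

theorem contMDiff_conj (a : G) : ContMDiff 𝓘(ℝ, E) 𝓘(ℝ, E) ∞ (fun y : G => a * y * a⁻¹) :=
  (contMDiff_const.mul contMDiff_id).mul contMDiff_const

theorem mdifferentiableAt_conj (a x : G) :
    MDifferentiableAt 𝓘(ℝ, E) 𝓘(ℝ, E) (fun y : G => a * y * a⁻¹) x :=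
  (contMDiff_conj E a).mdifferentiableAt (by simp)

theorem Ad_mul (a b : G) : Ad E (a * b) = (Ad E a).comp (Ad E b) := by
  rw [Ad, Ad, Ad, ← mderiv_comp (mdifferentiableAt_conj E a 1) (mdifferentiableAt_conj E b 1)
    (by simp)]
  simp only [mul_inv_rev, mul_assoc]

theorem Ad_mul_apply (a b : G) (X : E) : Ad E (a * b) X = Ad E a (Ad E b X) := by
  rw [Ad_mul]; rfl

theorem Ad_apply_inv (a : G) (X : E) : Ad E a (Ad E a⁻¹ X) = X := by
  rw [← Ad_mul_apply, mul_inv_cancel, Ad_one]; rfl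

theorem Ad_inv_apply (a : G) (X : E) : Ad E a⁻¹ (Ad E a X) = X := by
  rw [← Ad_mul_apply, inv_mul_cancel, Ad_one]; rfl

variable {E}

theorem IsBiInvariant.metForm_Ad {b : SmoothMetric E G} (hb : IsBiInvariant b) (a : G) (X Y : E) :
    metForm b 1 (Ad E a X) (Ad E a Y) = metForm b 1 X Y := by
  have hAd : Ad E a = (mderiv E E (fun y : G => y * a⁻¹) (a * 1)).comp
      (mderiv E E (fun y : G => a * y) 1) :=
    mderiv_comp (mdifferentiableAt_mul_right _ _) (mdifferentiableAt_mul_left _ _) rfl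
  calc metForm b 1 (Ad E a X) (Ad E a Y)
      = metForm b (a * 1 * a⁻¹) (Ad E a X) (Ad E a Y) := by rw [mul_one, mul_inv_cancel]
    _ = metForm b (a * 1) (mderiv E E (fun y : G => a * y) 1 X)
          (mderiv E E (fun y : G => a * y) 1 Y) := hAd ▸ hb.2 a⁻¹ (a * 1) _ _
    _ = metForm b 1 X Y := hb.1 a 1 X Y

theorem IsBiInvariant.metForm_Ad_left {b : SmoothMetric E G} (hb : IsBiInvariant b) (a : G)
    (X Y : E) : metForm b 1 (Ad E a X) Y = metForm b 1 X (Ad E a⁻¹ Y) := by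
  rw [← hb.metForm_Ad a X, Ad_apply_inv]

theorem mem_lieAlgebraOf {K : Subgroup G} {X : E} :
    X ∈ (lieAlgebraOf K : Submodule ℝ E) ↔ ∃ c : ℝ → G, ContMDiff 𝓘(ℝ, ℝ) 𝓘(ℝ, E) ∞ c ∧
      (∀ t, c t ∈ K) ∧ c 0 = 1 ∧ velocity E c 0 = X := Iff.rfl

theorem Ad_mem_lieAlgebraOf {H : Subgroup G} {a : G} (ha : a ∈ H) {X : E}
    (hX : X ∈ (lieAlgebraOf H : Submodule ℝ E)) :
    Ad E a X ∈ (lieAlgebraOf H : Submodule ℝ E) := by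
  obtain ⟨c, hc, hcH, hc0, rfl⟩ := mem_lieAlgebraOf.1 hX
  refine mem_lieAlgebraOf.2 ⟨fun t => a * c t * a⁻¹, (contMDiff_conj E a).comp hc,
    fun t => H.mul_mem (H.mul_mem ha (hcH t)) (H.inv_mem ha), by simp [hc0], ?_⟩
  exact velocity_comp (mdifferentiableAt_conj E a 1) (hc.mdifferentiableAt (by simp)) hc0

theorem contMDiffAt_Ad_one : ContMDiffAt 𝓘(ℝ, E) 𝓘(ℝ, E →L[ℝ] E) ∞ (Ad E : G → E →L[ℝ] E) 1 := by
  have hconj : ContMDiff (𝓘(ℝ, E).prod 𝓘(ℝ, E)) 𝓘(ℝ, E) ∞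
      (fun p : G × G => p.1 * p.2 * p.1⁻¹) :=
    (contMDiff_fst.mul contMDiff_snd).mul contMDiff_fst.inv
  have h := contMDiffAt_mderiv_inCharts (f := fun a y : G => a * y * a⁻¹)
    (g := fun _ : G => (1 : G)) (q₀ := (1 : G)) hconj.contMDiffAt contMDiffAt_const
  simp only [mul_one, inv_one, mul_inv_cancel, mderiv_extChartAt_self,
    mderiv_extChartAt_symm_self, ContinuousLinearMap.comp_id, ContinuousLinearMap.id_comp] at h
  exact h

variable (E G) in
/-- The differential at the identity of the adjoint representation. -/
def ad : E →L[ℝ] E →L[ℝ] E := mderiv E (E →L[ℝ] E) (Ad E : G → E →L[ℝ] E) 1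

theorem hasDerivAt_Ad {c : ℝ → G} {t : ℝ} (hc : MDifferentiableAt 𝓘(ℝ, ℝ) 𝓘(ℝ, E) c t)
    (hct : c t = 1) : HasDerivAt (fun s => Ad E (c s)) (ad E G (velocity E c t)) t := by
  have hAd : MDifferentiableAt 𝓘(ℝ, E) 𝓘(ℝ, E →L[ℝ] E) (Ad E : G → E →L[ℝ] E) 1 :=
    contMDiffAt_Ad_one.mdifferentiableAt (by simp)
  have hd : DifferentiableAt ℝ (fun s => Ad E (c s)) t :=
    (MDifferentiableAt.comp (g := Ad E) t (hct ▸ hAd) hc).differentiableAt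
  rw [ad, ← velocity_comp hAd hc hct, velocity_eq_deriv]
  exact hd.hasDerivAt

theorem isClosed_lieAlgebraOf [FiniteDimensional ℝ E] (H : Subgroup G) :
    IsClosed {X : E | X ∈ (lieAlgebraOf H : Submodule ℝ E)} := by
  have h (V : Submodule ℝ E) : IsClosed (V : Set E) := V.closed_of_finiteDimensional
  exact h (lieAlgebraOf H)

theorem ad_mem_lieAlgebraOf [FiniteDimensional ℝ E] {H : Subgroup G} {C Z : E}
    (hC : C ∈ (lieAlgebraOf H : Submodule ℝ E)) (hZ : Z ∈ (lieAlgebraOf H : Submodule ℝ E)) :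
    ad E G C Z ∈ (lieAlgebraOf H : Submodule ℝ E) := by
  obtain ⟨c, hc, hcH, hc0, rfl⟩ := mem_lieAlgebraOf.1 hC
  have h : HasDerivAt (fun s => Ad E (c s) Z) (ad E G (velocity E c 0) Z) 0 := by
    simpa using (hasDerivAt_Ad (hc.mdifferentiableAt (by simp)) hc0).clm_apply
      (hasDerivAt_const (0 : ℝ) Z)
  exact mem_of_hasDerivAt_of_forall_mem (isClosed_lieAlgebraOf H) h
    fun s => Ad_mem_lieAlgebraOf (hcH s) hZ

section Complete

variable [CompleteSpace E]

theorem hasDerivAt_Ad_lieExp (C : GroupLieAlgebra 𝓘(ℝ, E) G) (t : ℝ) :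
    HasDerivAt (fun s : ℝ => Ad E (lieExp (s • C)))
      ((ad E G C).comp (Ad E (lieExp (t • C)))) t := by
  have h0 : HasDerivAt (fun s : ℝ => Ad E (lieExp (s • C))) (ad E G C) (t - t) := by
    have h := hasDerivAt_Ad (mdifferentiableAt_lieExp_smul C 0) (lieExp_zero_smul C)
    rwa [velocity_lieExp_zero, ← sub_self t] at h
  have h1 := (h0.comp_sub_const t t).clm_comp (hasDerivAt_const t (Ad E (lieExp (t • C))))
  simp only [← Ad_mul, ← lieExp_add_smul, sub_add_cancel] at h1
  simpa using h1

theorem Ad_lieExp_self (X : GroupLieAlgebra 𝓘(ℝ, E) G) (t : ℝ) :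
    Ad E (lieExp (t • X)) (X : E) = X := by
  have hcomm : (fun s : ℝ => lieExp (t • X) * lieExp (s • X) * (lieExp (t • X))⁻¹)
      = fun s : ℝ => lieExp (s • X) := by
    funext s
    rw [← lieExp_neg_smul, ← lieExp_add_smul, ← lieExp_add_smul, add_neg_cancel_comm]
  have h := velocity_comp (mdifferentiableAt_conj E (lieExp (t • X)) 1)
    (mdifferentiableAt_lieExp_smul X 0) (lieExp_zero_smul X)
  rw [velocity_lieExp_zero, hcomm, velocity_lieExp_zero] at h
  exact h.symm

end Complete

variable [FiniteDimensional ℝ E]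

theorem Ad_lieExp_mem_lieAlgebraOf {H : Subgroup G} {C : GroupLieAlgebra 𝓘(ℝ, E) G}
    (hC : C ∈ lieAlgebraOf H) {Y : E} (hY : Y ∈ (lieAlgebraOf H : Submodule ℝ E)) (t : ℝ) :
    Ad E (lieExp (t • C)) Y ∈ (lieAlgebraOf H : Submodule ℝ E) := by
  have : CompleteSpace E := FiniteDimensional.complete ℝ E
  refine mem_of_hasDerivAt_apply (A := ad E G C) (f := fun s => Ad E (lieExp (s • C)) Y)
    (isClosed_lieAlgebraOf H) (fun Z => ad_mem_lieAlgebraOf hC) (fun s => ?_) ?_ t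
  · simpa using (hasDerivAt_Ad_lieExp C s).clm_apply (hasDerivAt_const s Y)
  · simp only [lieExp_zero_smul, Ad_one]
    exact hY

theorem IsBiInvariant.Ad_lieExp_mem_mOne {b : SmoothMetric E G} (hb : IsBiInvariant b)
    {H : Subgroup G} {C : GroupLieAlgebra 𝓘(ℝ, E) G} (hC : C ∈ lieAlgebraOf H) {Y : E}
    (hY : Y ∈ (mOne b H : Submodule ℝ E)) (t : ℝ) :
    Ad E (lieExp (t • C)) Y ∈ (mOne b H : Submodule ℝ E) := by
  have : CompleteSpace E := FiniteDimensional.complete ℝ E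
  intro Z hZ
  refine (hb.metForm_Ad_left _ Y Z).trans ?_
  rw [← lieExp_neg_smul]
  exact hY _ (Ad_lieExp_mem_lieAlgebraOf hC hZ _)

end Adjoint

section Submersions

variable {E : Type*} [NormedAddCommGroup E] [NormedSpace ℝ E]
  {F : Type*} [NormedAddCommGroup F] [NormedSpace ℝ F]
  {M : Type*} [TopologicalSpace M] [ChartedSpace E M]
  {N : Type*} [TopologicalSpace N] [ChartedSpace F N]

theorem exists_submersion_normal_form {f : M → N}
    (hf : Manifold.IsSubmersion 𝓘(ℝ, E) 𝓘(ℝ, F) ∞ f) (x : M) :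
    ∃ (φ : OpenPartialHomeomorph M E) (ψ : OpenPartialHomeomorph N F) (L : E →L[ℝ] F)
      (R : F →L[ℝ] E), φ ∈ IsManifold.maximalAtlas 𝓘(ℝ, E) ∞ M ∧
      ψ ∈ IsManifold.maximalAtlas 𝓘(ℝ, F) ∞ N ∧ x ∈ φ.source ∧
      (∀ y ∈ φ.source, f y ∈ ψ.source) ∧ (∀ y ∈ φ.source, ψ (f y) = L (φ y)) ∧
      ∀ w, L (R w) = w := by
  have h := hf.isSubmersionOfComplement_complement x
  refine ⟨h.domChart, h.codChart,
    (ContinuousLinearMap.fst ℝ F hf.complement).comp (h.equiv : E →L[ℝ] F × hf.complement),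
    (h.equiv.symm : F × hf.complement →L[ℝ] E).comp (ContinuousLinearMap.inl ℝ F hf.complement),
    h.domChart_mem_maximalAtlas, h.codChart_mem_maximalAtlas, h.mem_domChart_source,
    fun y hy => h.mapsto_domChart_source_codChart_source hy, fun y hy => ?_, fun w => by simp⟩
  have hz : h.domChart y ∈ (h.domChart.extend 𝓘(ℝ, E)).target := by
    simpa using h.domChart.map_source hy
  simpa [h.domChart.left_inv hy] using h.writtenInCharts hz

theorem exists_local_section {f : M → N} (hf : Manifold.IsSubmersion 𝓘(ℝ, E) 𝓘(ℝ, F) ∞ f) (x : M) :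
    ∃ σ : N → M, ContMDiffAt 𝓘(ℝ, F) 𝓘(ℝ, E) ∞ σ (f x) ∧ σ (f x) = x ∧
      ∀ᶠ y in 𝓝 (f x), f (σ y) = y := by
  obtain ⟨φ, ψ, L, R, hφ, hψ, hx, hmaps, hL, hLR⟩ := exists_submersion_normal_form hf x
  let τ : N → E := fun y => φ x + R (ψ y - ψ (f x))
  have hτx : τ (f x) = φ x := by simp [τ]
  have hτ : ContMDiffAt 𝓘(ℝ, F) 𝓘(ℝ, E) ∞ τ (f x) := by
    have h : ContDiff ℝ ∞ (fun w : F => φ x + R (w - ψ (f x))) := by fun_prop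
    exact h.contMDiff.contMDiffAt.comp (f x) (contMDiffAt_of_mem_maximalAtlas hψ (hmaps x hx))
  refine ⟨φ.symm ∘ τ, ContMDiffAt.comp_of_eq
    (contMDiffAt_symm_of_mem_maximalAtlas hφ (φ.map_source hx)) hτ hτx, ?_, ?_⟩
  · simp only [Function.comp_apply, hτx, φ.left_inv hx]
  · have hτtarget : ∀ᶠ y in 𝓝 (f x), τ y ∈ φ.target :=
      hτ.continuousAt.preimage_mem_nhds
        (φ.open_target.mem_nhds (hτx.symm ▸ φ.map_source hx))
    filter_upwards [hτtarget, ψ.open_source.mem_nhds (hmaps x hx)] with y hy hyψ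
    refine ψ.injOn (hmaps _ (φ.map_target hy)) hyψ ?_
    rw [hL _ (φ.map_target hy), φ.right_inv hy]
    simp [τ, hLR, hL x hx]

theorem mderiv_surjective_of_isSubmersion {f : M → N}
    (hf : Manifold.IsSubmersion 𝓘(ℝ, E) 𝓘(ℝ, F) ∞ f) (x : M) :
    Function.Surjective (mderiv E F f x) := by
  obtain ⟨σ, hσ, hσx, hfσ⟩ := exists_local_section hf x
  have h := mderiv_comp (hf.contMDiff.mdifferentiableAt (by simp))
    (hσ.mdifferentiableAt (by simp)) hσx
  rw [mderiv_congr hfσ, mderiv_id] at h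
  exact fun w => ⟨mderiv F E σ (f x) w, (DFunLike.congr_fun h w).symm⟩

theorem exists_contDiff_curve_of_isOpen {U : Set E} (hU : IsOpen U) {x : E} (hx : x ∈ U) (w : E) :
    ∃ (τ : ℝ → E) (r : ℝ → ℝ), ContDiff ℝ ∞ τ ∧ (∀ t, τ t ∈ U) ∧ (∀ t, τ t = x + r t • w) ∧
      τ 0 = x ∧ velocity E τ 0 = w := by
  obtain ⟨δ, hδ, hball⟩ := Metric.isOpen_iff.1 hU x hx
  let ε : ℝ := δ / (2 * (‖w‖ + 1))
  have hε : 0 < ε := by positivity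
  -- a curve defined for all times that stays close to `x` and starts in the direction `w`
  refine ⟨fun t => x + (ε * Real.sin (t / ε)) • w, fun t => ε * Real.sin (t / ε),
    by fun_prop, fun t => hball ?_, fun t => rfl, by simp, ?_⟩
  · rw [Metric.mem_ball, dist_eq_norm, add_sub_cancel_left]
    calc ‖(ε * Real.sin (t / ε)) • w‖
        = ε * |Real.sin (t / ε)| * ‖w‖ := by
          rw [norm_smul, Real.norm_eq_abs, abs_mul, abs_of_pos hε]
      _ ≤ ε * 1 * (‖w‖ + 1) := by
          gcongr
          · exact Real.abs_sin_le_one _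
          · linarith
      _ = δ / 2 := by simp only [ε]; field_simp
      _ < δ := half_lt_self hδ
  · have h := ((((hasDerivAt_id (0 : ℝ)).div_const ε).sin.const_mul ε).smul_const w).const_add x
    rw [velocity_eq_deriv]
    refine h.deriv.trans ?_
    simp [hε.ne']

theorem exists_curve_in_fibre {f : M → N} (hf : Manifold.IsSubmersion 𝓘(ℝ, E) 𝓘(ℝ, F) ∞ f) (x : M)
    {v : E} (hv : mderiv E F f x v = 0) :
    ∃ c : ℝ → M, ContMDiff 𝓘(ℝ, ℝ) 𝓘(ℝ, E) ∞ c ∧ (∀ t, f (c t) = f x) ∧ c 0 = x ∧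
      velocity E c 0 = v := by
  obtain ⟨φ, ψ, L, R, hφ, hψ, hx, hmaps, hL, -⟩ := exists_submersion_normal_form hf x
  have hφx : MDifferentiableAt 𝓘(ℝ, E) 𝓘(ℝ, E) φ x :=
    (contMDiffAt_of_mem_maximalAtlas hφ hx).mdifferentiableAt (by simp)
  have hφsymm : ∀ z ∈ φ.target, ContMDiffAt 𝓘(ℝ, E) 𝓘(ℝ, E) ∞ φ.symm z := fun z hz =>
    contMDiffAt_symm_of_mem_maximalAtlas hφ hz
  have hφsymm_x := (hφsymm _ (φ.map_source hx)).mdifferentiableAt (by simp)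
  have hinv : mderiv E E φ.symm (φ x) (mderiv E E φ x v) = v := by
    have h := mderiv_comp hφsymm_x hφx rfl
    rw [mderiv_congr (φ.eventually_left_inverse hx), mderiv_id] at h
    exact (DFunLike.congr_fun h v).symm
  have hker : L (mderiv E E φ x v) = 0 := by
    have hψx : MDifferentiableAt 𝓘(ℝ, F) 𝓘(ℝ, F) ψ (f x) :=
      (contMDiffAt_of_mem_maximalAtlas hψ (hmaps x hx)).mdifferentiableAt (by simp)
    have hψf := mderiv_comp hψx (hf.contMDiff.mdifferentiableAt (by simp)) rfl
    have hLφ := mderiv_comp (L.differentiableAt.mdifferentiableAt) hφx rfl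
    rw [← mderiv_congr (Filter.eventuallyEq_of_mem (φ.open_source.mem_nhds hx) hL), hψf,
      mderiv_eq_fderiv, L.fderiv] at hLφ
    simpa [hv] using (DFunLike.congr_fun hLφ v).symm
  obtain ⟨τ, r, hτ, hτtarget, hτr, hτ0, hτv⟩ :=
    exists_contDiff_curve_of_isOpen φ.open_target (φ.map_source hx) (mderiv E E φ x v)
  refine ⟨φ.symm ∘ τ, fun t => (hφsymm _ (hτtarget t)).comp t hτ.contMDiff.contMDiffAt,
    fun t => ?_, by simp only [Function.comp_apply, hτ0, φ.left_inv hx], ?_⟩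
  · refine ψ.injOn (hmaps _ (φ.map_target (hτtarget t))) (hmaps x hx) ?_
    rw [hL _ (φ.map_target (hτtarget t)), φ.right_inv (hτtarget t), hL x hx,
      hτr, map_add, map_smul, hker, smul_zero, add_zero]
  · exact (velocity_comp hφsymm_x (hτ.contMDiff.mdifferentiableAt (by simp)) hτ0).trans
      (by rw [hτv, hinv])

end Submersions

section HomogeneousSpaces

theorem t2Space_quotient {G : Type*} [TopologicalSpace G] [Group G] [IsTopologicalGroup G]
    (K : Subgroup G) [T1Space (G ⧸ K)] : T2Space (G ⧸ K) := by
  rw [t2Space_iff_of_isOpenQuotientMap (QuotientGroup.isOpenQuotientMap_mk (N := K))]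
  have hdiag : {q : G × G | (q.1 : G ⧸ K) = q.2} = (fun q => q.1⁻¹ * q.2) ⁻¹' (K : Set G) :=
    Set.ext fun _ => QuotientGroup.eq
  rw [hdiag]
  exact (QuotientGroup.t1Space_iff.1 inferInstance).preimage (by fun_prop)

variable {E : Type*} [NormedAddCommGroup E] [NormedSpace ℝ E]
  {F : Type*} [NormedAddCommGroup F] [NormedSpace ℝ F]
  {G : Type*} [TopologicalSpace G] [ChartedSpace E G] [Group G]
  {K : Subgroup G} [ChartedSpace F (G ⧸ K)]
  (hπ : Manifold.IsSubmersion 𝓘(ℝ, E) 𝓘(ℝ, F) ∞ (QuotientGroup.mk : G → G ⧸ K))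
include hπ

theorem mdifferentiableAt_mk (x : G) :
    MDifferentiableAt 𝓘(ℝ, E) 𝓘(ℝ, F) (QuotientGroup.mk : G → G ⧸ K) x :=
  hπ.contMDiff.mdifferentiableAt (by simp)

theorem finiteDimensional_of_isSubmersion_mk [FiniteDimensional ℝ E] : FiniteDimensional ℝ F :=
  FiniteDimensional.of_surjective (mderiv E F (QuotientGroup.mk : G → G ⧸ K) 1 : E →ₗ[ℝ] F)
    (mderiv_surjective_of_isSubmersion hπ 1)

variable [LieGroup 𝓘(ℝ, E) ∞ G]

theorem contMDiff_action :
    ContMDiff (𝓘(ℝ, E).prod 𝓘(ℝ, F)) 𝓘(ℝ, F) ∞ (fun p : G × (G ⧸ K) => p.1 • p.2) := by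
  rintro ⟨a, q⟩
  obtain ⟨x, rfl⟩ := QuotientGroup.mk_surjective q
  -- near `xK` the action is `(a, q) ↦ π (a * σ q)` for a local section `σ` of `π`
  obtain ⟨σ, hσ, -, hπσ⟩ := exists_local_section hπ x
  have hlift : ContMDiffAt (𝓘(ℝ, E).prod 𝓘(ℝ, F)) 𝓘(ℝ, E) ∞ (fun p : G × (G ⧸ K) => p.1 * σ p.2)
      (a, (x : G ⧸ K)) :=
    contMDiffAt_fst.mul (ContMDiffAt.comp (a, (x : G ⧸ K)) hσ contMDiffAt_snd)
  refine (ContMDiffAt.comp _ hπ.contMDiff.contMDiffAt hlift).congr_of_eventuallyEq ?_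
  filter_upwards [(continuous_snd.tendsto (a, (x : G ⧸ K))).eventually hπσ] with p hp
  exact congrArg (p.1 • ·) hp.symm

theorem contMDiff_smul_left (a : G) :
    ContMDiff 𝓘(ℝ, F) 𝓘(ℝ, F) ∞ (fun q : G ⧸ K => a • q) :=
  (contMDiff_action hπ).comp (contMDiff_const.prodMk contMDiff_id)

theorem mdifferentiableAt_smul_left (a : G) (q : G ⧸ K) :
    MDifferentiableAt 𝓘(ℝ, F) 𝓘(ℝ, F) (fun q : G ⧸ K => a • q) q :=
  (contMDiff_smul_left hπ a).mdifferentiableAt (by simp)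

theorem mderiv_mk_eq_zero_iff {X : E} :
    mderiv E F (QuotientGroup.mk : G → G ⧸ K) 1 X = 0 ↔ X ∈ (lieAlgebraOf K : Submodule ℝ E) := by
  rw [mem_lieAlgebraOf]
  constructor
  · intro h
    obtain ⟨c, hc, hcf, hc0, hcv⟩ := exists_curve_in_fibre hπ 1 h
    exact ⟨c, hc, fun t => by simpa using QuotientGroup.eq.1 (hcf t).symm, hc0, hcv⟩
  · rintro ⟨c, hc, hcK, hc0, rfl⟩
    have hconst : (fun s => (c s : G ⧸ K)) = fun _ => ((1 : G) : G ⧸ K) :=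
      funext fun s => (QuotientGroup.eq.2 (by simpa using hcK s)).symm
    rw [← velocity_comp (mdifferentiableAt_mk hπ 1) (hc.mdifferentiableAt (by simp)) hc0, hconst,
      velocity_eq_mderiv, mderiv_const]
    rfl

theorem mderiv_mul_smul (a b : G) (q : G ⧸ K) :
    mderiv F F (fun q : G ⧸ K => (a * b) • q) q
      = (mderiv F F (fun q : G ⧸ K => a • q) (b • q)).comp
        (mderiv F F (fun q : G ⧸ K => b • q) q) := by
  simp only [mul_smul]
  exact mderiv_comp (mdifferentiableAt_smul_left hπ a _) (mdifferentiableAt_smul_left hπ b _) rfl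

theorem mderiv_inv_smul_comp (a : G) (q : G ⧸ K) :
    (mderiv F F (fun q : G ⧸ K => a⁻¹ • q) (a • q)).comp (mderiv F F (fun q : G ⧸ K => a • q) q)
      = ContinuousLinearMap.id ℝ F := by
  rw [← mderiv_mul_smul hπ, inv_mul_cancel, ← mderiv_id q]
  simp only [one_smul]

theorem mderiv_smul_surjective (a : G) (q : G ⧸ K) :
    Function.Surjective (mderiv F F (fun q : G ⧸ K => a • q) q) := by
  have h := mderiv_inv_smul_comp hπ a⁻¹ (a • q)
  rw [inv_inv, inv_smul_smul] at h
  exact fun v => ⟨_, DFunLike.congr_fun h v⟩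

theorem mderiv_smul_mk_one {a : G} (ha : a ∈ K) (X : E) :
    mderiv F F (fun q : G ⧸ K => a • q) ((1 : G) : G ⧸ K)
        (mderiv E F (QuotientGroup.mk : G → G ⧸ K) 1 X)
      = mderiv E F (QuotientGroup.mk : G → G ⧸ K) 1 (Ad E a X) := by
  have hconj : (fun x : G => a • (x : G ⧸ K)) = fun x => ((a * x * a⁻¹ : G) : G ⧸ K) := by
    funext x
    refine QuotientGroup.eq.2 ?_
    change (a * x)⁻¹ * (a * x * a⁻¹) ∈ K
    rw [inv_mul_cancel_left]
    exact K.inv_mem ha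
  have h := mderiv_comp (mdifferentiableAt_smul_left hπ a ((1 : G) : G ⧸ K))
    (mdifferentiableAt_mk hπ (1 : G)) rfl
  rw [hconj, mderiv_comp (mdifferentiableAt_mk hπ (1 : G)) (mdifferentiableAt_conj E a 1)
    (by simp)] at h
  exact (DFunLike.congr_fun h X).symm

end HomogeneousSpaces

section TangentSpaceAtOrigin

variable {E : Type*} [NormedAddCommGroup E] [NormedSpace ℝ E]
  {F : Type*} [NormedAddCommGroup F] [NormedSpace ℝ F]
  {G : Type*} [TopologicalSpace G] [ChartedSpace E G] [Group G] [LieGroup 𝓘(ℝ, E) ∞ G]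
  {b : SmoothMetric E G} {K H : Subgroup G}

theorem lieAlgebraOf_mono (hKH : K ≤ H) :
    (lieAlgebraOf K : Submodule ℝ E) ≤ (lieAlgebraOf H : Submodule ℝ E) := by
  rintro _ ⟨c, hc, hcK, hc0, rfl⟩
  exact ⟨c, hc, fun t => hKH (hcK t), hc0, rfl⟩

variable [FiniteDimensional ℝ E] [ChartedSpace F (G ⧸ K)]

theorem exists_mOne_mTwo (b : SmoothMetric E G) (hKH : K ≤ H)
    (hπ : Manifold.IsSubmersion 𝓘(ℝ, E) 𝓘(ℝ, F) ∞ (QuotientGroup.mk : G → G ⧸ K)) (v : F) :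
    ∃ X₁ X₂ : E, X₁ ∈ (mOne b H : Submodule ℝ E) ∧ X₂ ∈ (mTwo b K H : Submodule ℝ E) ∧
      mderiv E F (QuotientGroup.mk : G → G ⧸ K) 1 (X₁ + X₂) = v := by
  obtain ⟨X, rfl⟩ := mderiv_surjective_of_isSubmersion hπ 1 v
  obtain ⟨X₁, X₂, Z, hX₁, hX₂, hZ, rfl⟩ :=
    exists_eq_add_add (isPosDef_metForm b 1) (lieAlgebraOf_mono (E := E) hKH) X
  refine ⟨X₁, X₂, hX₁, hX₂, ?_⟩
  rw [map_add _ (X₁ + X₂) Z, (mderiv_mk_eq_zero_iff hπ).2 hZ, add_zero]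

theorem existsUnique_mOne_mTwo (b : SmoothMetric E G) (hKH : K ≤ H)
    (hπ : Manifold.IsSubmersion 𝓘(ℝ, E) 𝓘(ℝ, F) ∞ (QuotientGroup.mk : G → G ⧸ K)) (v : F) :
    ∃! X : E × E, X.1 ∈ (mOne b H : Submodule ℝ E) ∧ X.2 ∈ (mTwo b K H : Submodule ℝ E) ∧
      mderiv E F (QuotientGroup.mk : G → G ⧸ K) 1 (X.1 + X.2) = v := by
  obtain ⟨X₁, X₂, hX₁, hX₂, rfl⟩ := exists_mOne_mTwo b hKH hπ v
  refine ⟨(X₁, X₂), ⟨hX₁, hX₂, rfl⟩, ?_⟩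
  rintro ⟨Y₁, Y₂⟩ ⟨hY₁, hY₂, hY⟩
  have hdiff : (Y₁ + Y₂ - (X₁ + X₂) : E) ∈ (lieAlgebraOf K : Submodule ℝ E) :=
    (mderiv_mk_eq_zero_iff hπ).1 (by rw [map_sub, hY, sub_self])
  have h := (isPosDef_metForm b 1).eq_and_eq_of_add_sub_add_mem (lieAlgebraOf_mono (E := E) hKH)
    hY₁ hY₂.1 hY₂.2 hX₁ hX₂.1 hX₂.2 hdiff
  exact Prod.ext h.1 h.2

end TangentSpaceAtOrigin

section InvariantMetrics

variable {E : Type*} [NormedAddCommGroup E] [NormedSpace ℝ E]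
  {F : Type*} [NormedAddCommGroup F] [NormedSpace ℝ F]
  {G : Type*} [TopologicalSpace G] [Group G] {K : Subgroup G} [ChartedSpace F (G ⧸ K)]

theorem IsInvariantMetric.metForm_smul [IsManifold 𝓘(ℝ, F) ∞ (G ⧸ K)]
    {g : SmoothMetric F (G ⧸ K)} (hg : IsInvariantMetric G g) (a : G) (q : G ⧸ K) (u v : F) :
    metForm g (a • q) (mderiv F F (fun q : G ⧸ K => a • q) q u)
      (mderiv F F (fun q : G ⧸ K => a • q) q v) = metForm g q u v :=
  hg a q u v

/-- The bilinear form `q₀` on `T_o(G/K)` is invariant under the isotropy representation of `K`. -/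
def IsIsotropyInvariant (K : Subgroup G) [ChartedSpace F (G ⧸ K)] (q₀ : F →L[ℝ] F →L[ℝ] ℝ) :
    Prop :=
  ∀ a ∈ K, pullForm q₀ (mderiv F F (fun x : G ⧸ K => a • x) ((1 : G) : G ⧸ K)) = q₀

/-- The value at `q` of the `G`-invariant extension of a form `q₀` on `T_o(G/K)`. It is defined
with a representative of `q`, whose choice is immaterial if `q₀` is invariant under the isotropy
representation. -/
def translateForm (q₀ : F →L[ℝ] F →L[ℝ] ℝ) (q : G ⧸ K) : F →L[ℝ] F →L[ℝ] ℝ :=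
  pullForm q₀ (mderiv F F (fun x : G ⧸ K => q.out⁻¹ • x) q)

variable [ChartedSpace E G] [LieGroup 𝓘(ℝ, E) ∞ G] {q₀ : F →L[ℝ] F →L[ℝ] ℝ}
  (hπ : Manifold.IsSubmersion 𝓘(ℝ, E) 𝓘(ℝ, F) ∞ (QuotientGroup.mk : G → G ⧸ K))

include hπ

theorem IsPosDef.translateForm (hq₀ : IsPosDef q₀) (q : G ⧸ K) :
    IsPosDef (translateForm q₀ q) := by
  refine hq₀.pullForm (Function.LeftInverse.injective
    (g := mderiv F F (fun x : G ⧸ K => q.out⁻¹⁻¹ • x) (q.out⁻¹ • q)) fun u => ?_)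
  exact DFunLike.congr_fun (mderiv_inv_smul_comp hπ q.out⁻¹ q) u

theorem translateForm_mk (hq₀ : IsIsotropyInvariant K q₀) (a : G) :
    translateForm q₀ (a : G ⧸ K)
      = pullForm q₀ (mderiv F F (fun x : G ⧸ K => a⁻¹ • x) (a : G ⧸ K)) := by
  set c : G := Quotient.out (a : G ⧸ K)
  have hac : a⁻¹ * c ∈ K := QuotientGroup.eq.1 (QuotientGroup.out_eq' (a : G ⧸ K)).symm
  have hca : c⁻¹ • (a : G ⧸ K) = ((1 : G) : G ⧸ K) :=
    QuotientGroup.eq.2 (by simpa using K.inv_mem (K.inv_mem hac))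
  have hmul := mderiv_mul_smul hπ (a⁻¹ * c) c⁻¹ (a : G ⧸ K)
  rw [mul_inv_cancel_right, hca] at hmul
  rw [hmul]
  conv_lhs => rw [← hq₀ _ hac]
  rfl

theorem pullForm_translateForm_smul (hq₀ : IsIsotropyInvariant K q₀) (a : G) (q : G ⧸ K) :
    pullForm (translateForm q₀ (a • q)) (mderiv F F (fun x : G ⧸ K => a • x) q)
      = translateForm q₀ q := by
  obtain ⟨x, rfl⟩ := QuotientGroup.mk_surjective q
  have hax : a • (x : G ⧸ K) = ((a * x : G) : G ⧸ K) := rfl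
  have hmul := mderiv_mul_smul hπ (a * x)⁻¹ a (x : G ⧸ K)
  rw [mul_inv_rev, inv_mul_cancel_right, ← mul_inv_rev] at hmul
  rw [translateForm_mk hπ hq₀ x, hmul, hax, translateForm_mk hπ hq₀]
  rfl

theorem translateForm_one (hq₀ : IsIsotropyInvariant K q₀) :
    translateForm q₀ ((1 : G) : G ⧸ K) = q₀ := by
  rw [translateForm_mk hπ hq₀]
  simp only [inv_one, one_smul, mderiv_id]
  rfl

variable [IsManifold 𝓘(ℝ, F) ∞ (G ⧸ K)]

theorem contMDiffAt_translateForm (hq₀ : IsIsotropyInvariant K q₀) (p : G ⧸ K) :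
    ContMDiffAt 𝓘(ℝ, F) 𝓘(ℝ, F →L[ℝ] F →L[ℝ] ℝ) ∞
      (fun q : G ⧸ K => pullForm (translateForm q₀ q)
        (mderiv F F (extChartAt 𝓘(ℝ, F) p).symm (extChartAt 𝓘(ℝ, F) p q))) p := by
  obtain ⟨x, rfl⟩ := QuotientGroup.mk_surjective p
  -- a local section `σ` of `π` provides representatives `σ q` which depend smoothly on `q`
  obtain ⟨σ, hσ, -, hπσ⟩ := exists_local_section hπ x
  have hact : ContMDiffAt (𝓘(ℝ, F).prod 𝓘(ℝ, F)) 𝓘(ℝ, F) ∞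
      (fun r : (G ⧸ K) × (G ⧸ K) => (σ r.1)⁻¹ • r.2) ((x : G ⧸ K), (x : G ⧸ K)) :=
    ContMDiffAt.comp (g := fun r : G × (G ⧸ K) => r.1 • r.2)
      (f := fun r : (G ⧸ K) × (G ⧸ K) => ((σ r.1)⁻¹, r.2)) _ (contMDiff_action hπ).contMDiffAt
      ((ContMDiffAt.comp ((x : G ⧸ K), (x : G ⧸ K)) hσ contMDiffAt_fst).inv.prodMk
        contMDiffAt_snd)
  have hder := contMDiffAt_mderiv_inCharts (f := fun q r : G ⧸ K => (σ q)⁻¹ • r)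
    (g := fun q => q) (q₀ := (x : G ⧸ K)) hact contMDiffAt_id
  have horigin : ∀ q : G ⧸ K, (σ q : G ⧸ K) = q → (σ q)⁻¹ • q = ((1 : G) : G ⧸ K) :=
    fun q hq => (congrArg ((σ q)⁻¹ • ·) hq.symm).trans
      (congrArg (QuotientGroup.mk : G → G ⧸ K) (inv_mul_cancel (σ q)))
  refine (contMDiffAt_pullForm (b := fun _ => q₀) contMDiffAt_const hder).congr_of_eventuallyEq ?_
  filter_upwards [hπσ] with q hq
  have hform := translateForm_mk hπ hq₀ (σ q)
  rw [hq] at hform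
  simp only [horigin _ hπσ.self_of_nhds, horigin q hq, mderiv_extChartAt_self,
    ContinuousLinearMap.id_comp, hform]
  rfl

theorem exists_invariantMetric [FiniteDimensional ℝ F] (hsymm : ∀ u v, q₀ u v = q₀ v u)
    (hpos : IsPosDef q₀) (hq₀ : IsIsotropyInvariant K q₀) :
    ∃ g : SmoothMetric F (G ⧸ K), IsInvariantMetric G g ∧ metForm g ((1 : G) : G ⧸ K) = q₀ :=
  ⟨{ inner := translateForm q₀
     symm := fun _ _ _ => hsymm _ _
     pos := hpos.translateForm hπ
     isVonNBounded := fun q => (hpos.translateForm hπ q).isVonNBounded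
     contMDiff := fun q =>
      (contMDiffAt_bilin_section_iff _ q).2 (contMDiffAt_translateForm hπ hq₀ q) },
    fun a q u v => DFunLike.congr_fun
      (DFunLike.congr_fun (pullForm_translateForm_smul hπ hq₀ a q) u) v,
    translateForm_one hπ hq₀⟩

theorem IsInvariantMetric.eq_of_origin {g g' : SmoothMetric F (G ⧸ K)}
    (hg : IsInvariantMetric G g) (hg' : IsInvariantMetric G g')
    (h : metForm g ((1 : G) : G ⧸ K) = metForm g' ((1 : G) : G ⧸ K)) : g = g' := by
  have hform : metForm g = metForm g' := by
    funext q
    obtain ⟨a, rfl⟩ := QuotientGroup.mk_surjective q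
    have ha : a • ((1 : G) : G ⧸ K) = (a : G ⧸ K) := congrArg QuotientGroup.mk (mul_one a)
    rw [← ha]
    ext u v
    obtain ⟨u, rfl⟩ := mderiv_smul_surjective hπ a ((1 : G) : G ⧸ K) u
    obtain ⟨v, rfl⟩ := mderiv_smul_surjective hπ a ((1 : G) : G ⧸ K) v
    rw [hg.metForm_smul, hg'.metForm_smul, h]
  cases g
  cases g'
  congr

end InvariantMetrics

section DeformedMetric

variable {E : Type*} [NormedAddCommGroup E] [NormedSpace ℝ E]
  {F : Type*} [NormedAddCommGroup F] [NormedSpace ℝ F]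
  {G : Type*} [TopologicalSpace G] [ChartedSpace E G] [Group G] [LieGroup 𝓘(ℝ, E) ∞ G]
  {b : SmoothMetric E G} {K H : Subgroup G} {lam : ℝ}

/-- The metric endomorphism `Λ` of `𝔤` of the deformed metric: it is zero on `𝔨`, the identity on
`𝔪₁` and `lam` on `𝔪₂`, so that the inner product at the origin is induced by `B(Λ X, Y)`. -/
def metricEndo (b : SmoothMetric E G) (K H : Subgroup G) (lam : ℝ) : E →L[ℝ] E :=
  deformOp (metForm b 1) (lieAlgebraOf K : Submodule ℝ E) (lieAlgebraOf H : Submodule ℝ E) lam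

variable [FiniteDimensional ℝ E]

theorem metricEndo_add (hKH : K ≤ H) {X₁ X₂ : E} (hX₁ : X₁ ∈ (mOne b H : Submodule ℝ E))
    (hX₂ : X₂ ∈ (mTwo b K H : Submodule ℝ E)) :
    metricEndo b K H lam (X₁ + X₂) = X₁ + lam • X₂ :=
  deformOp_add (isPosDef_metForm b 1) (lieAlgebraOf_mono (E := E) hKH) hX₁ hX₂.1 hX₂.2

theorem IsBiInvariant.metricEndo_Ad (hb : IsBiInvariant b) (hKH : K ≤ H) {a : G} (ha : a ∈ K)
    (X : E) : metricEndo b K H lam (Ad E a X) = Ad E a (metricEndo b K H lam X) :=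
  deformOp_comm (isPosDef_metForm b 1) (hb.metForm_Ad a) (fun _ => Ad_mem_lieAlgebraOf ha)
    (fun _ => Ad_mem_lieAlgebraOf (K.inv_mem ha)) (fun _ => Ad_mem_lieAlgebraOf (hKH ha))
    (fun _ => Ad_mem_lieAlgebraOf (H.inv_mem (hKH ha))) (Ad_apply_inv E a) X

variable [ChartedSpace F (G ⧸ K)]
  (hπ : Manifold.IsSubmersion 𝓘(ℝ, E) 𝓘(ℝ, F) ∞ (QuotientGroup.mk : G → G ⧸ K))
include hπ

theorem exists_isotropyInvariant_form (hb : IsBiInvariant b) (hKH : K ≤ H) (hlam : 0 < lam) :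
    ∃ q₀ : F →L[ℝ] F →L[ℝ] ℝ, (∀ u v, q₀ u v = q₀ v u) ∧ IsPosDef q₀ ∧
      IsIsotropyInvariant K q₀ ∧ ∀ X Y, q₀ (mderiv E F (QuotientGroup.mk : G → G ⧸ K) 1 X)
        (mderiv E F (QuotientGroup.mk : G → G ⧸ K) 1 Y)
          = metForm b 1 (metricEndo b K H lam X) Y := by
  have hpos := isPosDef_metForm b (1 : G)
  have hsymm := metForm_symm b (1 : G)
  have hle := lieAlgebraOf_mono (E := E) hKH
  have hker {X : E} (hX : mderiv E F (QuotientGroup.mk : G → G ⧸ K) 1 X = 0) (Y : E) :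
      deformedForm (metForm b 1) (lieAlgebraOf K : Submodule ℝ E)
        (lieAlgebraOf H : Submodule ℝ E) lam X Y = 0 :=
    deformedForm_eq_zero_of_mem_left hpos hle ((mderiv_mk_eq_zero_iff hπ).1 hX) Y
  have hsurj := mderiv_surjective_of_isSubmersion hπ 1
  have : FiniteDimensional ℝ F := finiteDimensional_of_isSubmersion_mk hπ
  obtain ⟨q₀, hq₀⟩ := exists_pullForm_eq hsurj (fun X Y hX => hker hX Y)
    (fun X Y hY => (deformedForm_symm hpos hsymm X Y).trans (hker hY X))
  have hq (X Y : E) := DFunLike.congr_fun (DFunLike.congr_fun hq₀ X) Y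
  refine ⟨q₀, fun u v => ?_, fun u hu => ?_, fun a ha => ?_, hq⟩
  · obtain ⟨X, rfl⟩ := hsurj u
    obtain ⟨Y, rfl⟩ := hsurj v
    exact (hq X Y).trans ((deformedForm_symm hpos hsymm X Y).trans (hq Y X).symm)
  · obtain ⟨X, rfl⟩ := hsurj u
    exact (deformedForm_pos hpos hsymm hle hlam
      (mt (mderiv_mk_eq_zero_iff hπ).2 hu)).trans_eq (hq X X).symm
  · ext u v
    obtain ⟨X, rfl⟩ := hsurj u
    obtain ⟨Y, rfl⟩ := hsurj v
    rw [pullForm_apply, mderiv_smul_mk_one hπ ha, mderiv_smul_mk_one hπ ha]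
    refine (hq _ _).trans (Eq.trans ?_ (hq X Y).symm)
    exact (congrArg (metForm b 1 · (Ad E a Y)) (hb.metricEndo_Ad hKH ha X)).trans
      (hb.metForm_Ad a _ Y)

variable [IsManifold 𝓘(ℝ, F) ∞ (G ⧸ K)] {g : SmoothMetric F (G ⧸ K)}

theorem isDeformedMetric_iff (hKH : K ≤ H) : IsDeformedMetric b K H lam g ↔
    IsInvariantMetric G g ∧ ∀ X Y, metForm g ((1 : G) : G ⧸ K)
      (mderiv E F (QuotientGroup.mk : G → G ⧸ K) 1 X)
      (mderiv E F (QuotientGroup.mk : G → G ⧸ K) 1 Y)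
        = metForm b 1 (metricEndo b K H lam X) Y := by
  have hpos := isPosDef_metForm b (1 : G)
  have hsymm := metForm_symm b (1 : G)
  have hle := lieAlgebraOf_mono (E := E) hKH
  refine and_congr_right fun _ => ⟨fun h X Y => ?_, fun h X₁ hX₁ X₂ hX₂ Y₁ hY₁ Y₂ hY₂ => ?_⟩
  · have hmod {X Z : E} (hZ : Z ∈ (lieAlgebraOf K : Submodule ℝ E)) :
        mderiv E F (QuotientGroup.mk : G → G ⧸ K) 1 (X + Z)
          = mderiv E F (QuotientGroup.mk : G → G ⧸ K) 1 X :=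
      (map_add _ X Z).trans (by rw [(mderiv_mk_eq_zero_iff hπ).2 hZ, add_zero])
    obtain ⟨X₁, X₂, Z, hX₁, hX₂, hZ, rfl⟩ := exists_eq_add_add hpos hle X
    obtain ⟨Y₁, Y₂, Z', hY₁, hY₂, hZ', rfl⟩ := exists_eq_add_add hpos hle Y
    rw [hmod hZ, hmod hZ']
    exact (h X₁ hX₁ X₂ hX₂ Y₁ hY₁ Y₂ hY₂).trans
      (deformedForm_add_add_add hpos hsymm hle hX₁ hX₂.1 hX₂.2 hZ hY₁ hY₂.1 hZ').symm
  · exact (h _ _).trans (deformedForm_add_add hpos hsymm hle hX₁ hX₂.1 hX₂.2 hY₁ hY₂.1)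

theorem existsUnique_isDeformedMetric (hb : IsBiInvariant b) (hKH : K ≤ H) (hlam : 0 < lam) :
    ∃! g : SmoothMetric F (G ⧸ K), IsDeformedMetric b K H lam g := by
  have : FiniteDimensional ℝ F := finiteDimensional_of_isSubmersion_mk hπ
  obtain ⟨q₀, hsymm, hpos, hinv, hq₀⟩ := exists_isotropyInvariant_form hπ hb hKH hlam
  obtain ⟨g, hg, rfl⟩ := exists_invariantMetric hπ hsymm hpos hinv
  refine ⟨g, (isDeformedMetric_iff hπ hKH).2 ⟨hg, hq₀⟩, fun g' hg' => ?_⟩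
  obtain ⟨hg', hq'⟩ := (isDeformedMetric_iff hπ hKH).1 hg'
  refine hg'.eq_of_origin hπ hg ?_
  ext u v
  obtain ⟨X, rfl⟩ := mderiv_surjective_of_isSubmersion hπ 1 u
  obtain ⟨Y, rfl⟩ := mderiv_surjective_of_isSubmersion hπ 1 v
  rw [hq', hq₀]

end DeformedMetric

section Noether

variable {E : Type*} [NormedAddCommGroup E] [NormedSpace ℝ E]
  {F : Type*} [NormedAddCommGroup F] [NormedSpace ℝ F]
  {G : Type*} [TopologicalSpace G] [ChartedSpace E G] [Group G] [LieGroup 𝓘(ℝ, E) ∞ G]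
  {K : Subgroup G} [ChartedSpace F (G ⧸ K)]

/-- The value at `q` of the fundamental vector field on `G/K` generated by `Z : 𝔤`, which is the
derivative at the identity of the orbit map `a ↦ a • q` in the direction `Z`. -/
def fundamentalField (F : Type*) [NormedAddCommGroup F] [NormedSpace ℝ F] [ChartedSpace F (G ⧸ K)]
    (Z : E) (q : G ⧸ K) : F :=
  mderiv E F (fun a : G => a • q) 1 Z

variable (hπ : Manifold.IsSubmersion 𝓘(ℝ, E) 𝓘(ℝ, F) ∞ (QuotientGroup.mk : G → G ⧸ K))
include hπ

theorem fundamentalField_mk (x : G) (Z : E) :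
    fundamentalField F Z (x : G ⧸ K)
      = mderiv F F (fun q : G ⧸ K => x • q) ((1 : G) : G ⧸ K)
        (mderiv E F (QuotientGroup.mk : G → G ⧸ K) 1 (Ad E x⁻¹ Z)) := by
  have hconj : (fun a : G => a • (x : G ⧸ K))
      = fun a => x • ((x⁻¹ * a * x⁻¹⁻¹ : G) : G ⧸ K) := by
    funext a
    refine congrArg (QuotientGroup.mk : G → G ⧸ K) ?_
    simp [mul_assoc]
  have hd : MDifferentiableAt 𝓘(ℝ, E) 𝓘(ℝ, F)
      (fun a : G => ((x⁻¹ * a * x⁻¹⁻¹ : G) : G ⧸ K)) 1 :=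
    (mdifferentiableAt_mk hπ _).comp (1 : G) (mdifferentiableAt_conj E x⁻¹ 1)
  rw [fundamentalField, hconj,
    mderiv_comp (mdifferentiableAt_smul_left hπ x ((1 : G) : G ⧸ K)) hd (by simp),
    mderiv_comp (mdifferentiableAt_mk hπ (1 : G)) (mdifferentiableAt_conj E x⁻¹ 1) (by simp)]
  rfl

theorem exists_fundamentalField_eq (q : G ⧸ K) (v : F) :
    ∃ Z : E, fundamentalField F Z q = v := by
  obtain ⟨x, rfl⟩ := QuotientGroup.mk_surjective q
  obtain ⟨u, hu⟩ := mderiv_smul_surjective hπ x ((1 : G) : G ⧸ K) v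
  obtain ⟨X, rfl⟩ := mderiv_surjective_of_isSubmersion hπ 1 u
  exact ⟨Ad E x X, by rw [fundamentalField_mk hπ, Ad_inv_apply]; exact hu⟩

variable [CompleteSpace E]

theorem velocity_lieExp_smul_action (Z : GroupLieAlgebra 𝓘(ℝ, E) G) (q : G ⧸ K) :
    velocity F (fun s : ℝ => lieExp (s • Z) • q) 0 = fundamentalField (E := E) F Z q := by
  have horbit : MDifferentiableAt 𝓘(ℝ, E) 𝓘(ℝ, F) (fun a : G => a • q) 1 :=
    ((contMDiff_action hπ).comp (contMDiff_id.prodMk contMDiff_const)).mdifferentiableAt (by simp)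
  refine (velocity_comp horbit (mdifferentiableAt_lieExp_smul Z 0) (lieExp_zero_smul Z)).trans ?_
  rw [velocity_lieExp_zero]
  rfl

variable [IsManifold 𝓘(ℝ, F) ∞ (G ⧸ K)] {g : SmoothMetric F (G ⧸ K)} {γ : ℝ → G ⧸ K}

-- The isometries `exp(sZ)` do not change the speed of `γ`, so that only the derivative of the
-- momentum remains in the first variation formula for `(s, t) ↦ exp(sZ) • γ t`.
theorem IsInvariantMetric.covariantAccel_fundamentalField (hg : IsInvariantMetric G g)
    (hγ : ContMDiff 𝓘(ℝ, ℝ) 𝓘(ℝ, F) ∞ γ) {t : ℝ} {p : G ⧸ K}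
    (hp : γ t ∈ (chartAt F p).source) {Z : E}
    (hmom : ∀ t', metForm g (γ t') (velocity F γ t') (fundamentalField F Z (γ t'))
      = metForm g (γ t) (velocity F γ t) (fundamentalField F Z (γ t))) :
    covariantAccel (chartForm g p) (fun s => extChartAt 𝓘(ℝ, F) p (γ s)) t
      (mderiv F F (extChartAt 𝓘(ℝ, F) p) (γ t) (fundamentalField F Z (γ t))) = 0 := by
  let z : ℝ → G := fun s => lieExp (s • (Z : GroupLieAlgebra 𝓘(ℝ, E) G))
  have hz₀ : z 0 = 1 := lieExp_zero_smul _
  let σ : ℝ × ℝ → G ⧸ K := fun r => z r.1 • γ r.2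
  have hσ : ContMDiff 𝓘(ℝ, ℝ × ℝ) 𝓘(ℝ, F) ∞ σ :=
    (contMDiff_action hπ).comp
      (((contMDiff_lieExp_smul _).comp contDiff_fst.contMDiff).prodMk
        (hγ.comp contDiff_snd.contMDiff))
  have hσ₀ : (fun r => σ (0, r)) = γ := by
    funext r
    simp only [σ, hz₀, one_smul]
  have hσ₀' (r : ℝ) : σ (0, r) = γ r := congrFun hσ₀ r
  have hσZ (r : ℝ) : velocity F (fun s => σ (s, r)) 0 = fundamentalField F Z (γ r) :=
    velocity_lieExp_smul_action hπ _ (γ r)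
  have hspeed (s : ℝ) : metForm g (σ (s, t)) (velocity F (fun r => σ (s, r)) t)
      (velocity F (fun r => σ (s, r)) t) = metForm g (γ t) (velocity F γ t) (velocity F γ t) := by
    have hvel : velocity F (fun r => σ (s, r)) t
        = mderiv F F (fun q : G ⧸ K => z s • q) (γ t) (velocity F γ t) :=
      velocity_comp (mdifferentiableAt_smul_left hπ (z s) (γ t))
        (hγ.mdifferentiableAt (by simp)) rfl
    rw [hvel]
    exact hg.metForm_smul (z s) (γ t) _ _
  have h := covariantAccel_chartForm_variation_eq_zero (g := g) (p := p) (t := t) hσ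
    (by rwa [hσ₀']) (fun s => (hspeed s).trans (by rw [hσ₀', hσ₀]))
    (fun t' => by rw [hσZ, hσZ, hσ₀', hσ₀', hσ₀]; exact hmom t')
  simpa only [hσZ, hσ₀'] using h

theorem IsInvariantMetric.isGeodesicOn_of_momentum_const (hg : IsInvariantMetric G g)
    (hγ : ContMDiff 𝓘(ℝ, ℝ) 𝓘(ℝ, F) ∞ γ)
    (hmom : ∀ (Z : E) (t t' : ℝ),
      metForm g (γ t) (velocity F γ t) (fundamentalField F Z (γ t))
        = metForm g (γ t') (velocity F γ t') (fundamentalField F Z (γ t'))) :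
    IsGeodesicOn g γ Set.univ := by
  refine isGeodesicOn_iff.2 ⟨hγ.contMDiffOn, fun t _ p hp => ?_⟩
  have hp' : γ t ∈ (extChartAt 𝓘(ℝ, F) p).source := by simpa using hp
  ext w
  obtain ⟨Z, hZ⟩ := exists_fundamentalField_eq hπ (γ t)
    (mderiv F F (extChartAt 𝓘(ℝ, F) p).symm (extChartAt 𝓘(ℝ, F) p (γ t)) w)
  have hw : mderiv F F (extChartAt 𝓘(ℝ, F) p) (γ t) (fundamentalField F Z (γ t)) = w := by
    have h := DFunLike.congr_fun
      (mderiv_extChartAt_comp_symm ((extChartAt 𝓘(ℝ, F) p).map_source hp')) w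
    rw [(extChartAt 𝓘(ℝ, F) p).left_inv hp'] at h
    rw [hZ]
    exact h
  rw [← hw]
  exact hg.covariantAccel_fundamentalField hπ hγ hp fun t' => hmom Z t' t

end Noether

section TwoStepCurves

variable {E : Type*} [NormedAddCommGroup E] [NormedSpace ℝ E]
  {G : Type*} [TopologicalSpace G] [ChartedSpace E G] [Group G] {K : Subgroup G}

theorem twoStepCurve_eq (X Y : GroupLieAlgebra 𝓘(ℝ, E) G) : twoStepCurve K X Y
    = fun t : ℝ => ((lieExp (t • X) * lieExp (t • Y) : G) : G ⧸ K) :=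
  funext fun _ => congrArg (QuotientGroup.mk : G → G ⧸ K) (mul_one _)

/-- The left logarithmic derivative `Ad(d⁻¹) X + Y` of the product of two curves of a Lie group,
the second one being at `d`, whose left logarithmic derivatives are `X` and `Y`. -/
def mulLogDeriv (d : G) (X Y : E) : E :=
  Ad E d⁻¹ X + Y

theorem mulLogDeriv_one (X Y : E) : mulLogDeriv (1 : G) X Y = X + Y := by
  rw [mulLogDeriv, inv_one, Ad_one, ContinuousLinearMap.id_apply]

variable [LieGroup 𝓘(ℝ, E) ∞ G]

theorem mderiv_mul_right_eq_comp_Ad (c d : G) :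
    (mderiv E E (fun y : G => y * d) c).comp (mderiv E E (fun y : G => c * y) 1)
      = (mderiv E E (fun y : G => c * d * y) 1).comp (Ad E d⁻¹) := by
  have hconj : (fun y : G => c * d * (d⁻¹ * y * d⁻¹⁻¹)) = fun y => c * y * d := by
    funext y
    group
  rw [Ad, ← mderiv_comp (mdifferentiableAt_mul_right d c) (mdifferentiableAt_mul_left c 1)
    (mul_one c), ← mderiv_comp (mdifferentiableAt_mul_left (c * d) 1)
    (mdifferentiableAt_conj E d⁻¹ 1) (by simp), hconj]

variable [CompleteSpace E]

theorem velocity_lieExp_mul_lieExp (X Y : GroupLieAlgebra 𝓘(ℝ, E) G) (t : ℝ) :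
    velocity E (fun t : ℝ => lieExp (t • X) * lieExp (t • Y)) t
      = mderiv E E (fun y : G => lieExp (t • X) * lieExp (t • Y) * y) 1
        (mulLogDeriv (E := E) (lieExp (t • Y)) X Y) := by
  have hmul : MDifferentiableAt (𝓘(ℝ, E).prod 𝓘(ℝ, E)) 𝓘(ℝ, E) (fun p : G × G => p.1 * p.2)
      (lieExp (t • X), lieExp (t • Y)) :=
    (contMDiff_mul 𝓘(ℝ, E) ∞).mdifferentiableAt (by simp)
  have hprod := velocity_comp₂ (f := fun x y : G => x * y) (c := fun t => lieExp (t • X))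
    (d := fun t => lieExp (t • Y)) hmul (mdifferentiableAt_lieExp_smul X t)
    (mdifferentiableAt_lieExp_smul Y t)
  rw [velocity_lieExp_smul, velocity_lieExp_smul] at hprod
  refine hprod.trans (Eq.trans (congrArg₂ (· + ·) ?_ ?_) (map_add _ _ _).symm)
  · exact DFunLike.congr_fun
      (mderiv_mul_right_eq_comp_Ad (E := E) (lieExp (t • X)) (lieExp (t • Y))) X
  · have hassoc := mderiv_comp (mdifferentiableAt_mul_left (E := E) (lieExp (t • X)) _)
      (mdifferentiableAt_mul_left (E := E) (lieExp (t • Y)) 1) (mul_one _)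
    simp only [← mul_assoc] at hassoc
    exact (DFunLike.congr_fun hassoc Y).symm

theorem twoStepCurve_zero (X Y : GroupLieAlgebra 𝓘(ℝ, E) G) :
    twoStepCurve K X Y 0 = ((1 : G) : G ⧸ K) := by
  simp only [twoStepCurve_eq, lieExp_zero_smul, mul_one]

variable {F : Type*} [NormedAddCommGroup F] [NormedSpace ℝ F] [ChartedSpace F (G ⧸ K)]
  (hπ : Manifold.IsSubmersion 𝓘(ℝ, E) 𝓘(ℝ, F) ∞ (QuotientGroup.mk : G → G ⧸ K))
include hπ

theorem contMDiff_twoStepCurve (X Y : GroupLieAlgebra 𝓘(ℝ, E) G) :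
    ContMDiff 𝓘(ℝ, ℝ) 𝓘(ℝ, F) ∞ (twoStepCurve K X Y) := by
  rw [twoStepCurve_eq]
  exact hπ.contMDiff.comp ((contMDiff_lieExp_smul X).mul (contMDiff_lieExp_smul Y))

theorem velocity_twoStepCurve (X Y : GroupLieAlgebra 𝓘(ℝ, E) G) (t : ℝ) :
    velocity F (twoStepCurve K X Y) t
      = mderiv F F (fun q : G ⧸ K => (lieExp (t • X) * lieExp (t • Y)) • q) ((1 : G) : G ⧸ K)
        (mderiv E F (QuotientGroup.mk : G → G ⧸ K) 1
          (mulLogDeriv (E := E) (lieExp (t • Y)) X Y)) := by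
  rw [twoStepCurve_eq,
    velocity_comp (γ := fun t => lieExp (t • X) * lieExp (t • Y)) (mdifferentiableAt_mk hπ _)
    (((contMDiff_lieExp_smul X).mul (contMDiff_lieExp_smul Y)).mdifferentiableAt (by simp)) rfl,
    velocity_lieExp_mul_lieExp]
  set a : G := lieExp (t • X) * lieExp (t • Y)
  have hleft := mderiv_comp (mdifferentiableAt_mk hπ a) (mdifferentiableAt_mul_left (E := E) a 1)
    (mul_one a)
  have hright := mderiv_comp (mdifferentiableAt_smul_left hπ a ((1 : G) : G ⧸ K))
    (mdifferentiableAt_mk hπ 1) rfl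
  exact DFunLike.congr_fun (hleft.symm.trans hright) _

theorem velocity_twoStepCurve_zero (X Y : GroupLieAlgebra 𝓘(ℝ, E) G) :
    velocity F (twoStepCurve K X Y) 0 = dProj F K (X + Y) := by
  rw [velocity_twoStepCurve hπ]
  simp only [lieExp_zero_smul, mul_one, one_smul, mderiv_id]
  exact congrArg (mderiv E F (QuotientGroup.mk : G → G ⧸ K) 1) (mulLogDeriv_one (E := E) X Y)

theorem velocity_twoStepCurve_deformed_zero (X₁ X₂ : GroupLieAlgebra 𝓘(ℝ, E) G) (lam : ℝ) :
    velocity F (twoStepCurve K (X₁ + lam • X₂) ((1 - lam) • X₂)) 0 = dProj F K (X₁ + X₂) := by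
  rw [velocity_twoStepCurve_zero hπ]
  congr 1
  module

end TwoStepCurves

section TwoStepGeodesics

variable {E : Type*} [NormedAddCommGroup E] [NormedSpace ℝ E] [FiniteDimensional ℝ E]
  {G : Type*} [TopologicalSpace G] [ChartedSpace E G] [Group G] [LieGroup 𝓘(ℝ, E) ∞ G]
  {b : SmoothMetric E G} {K H : Subgroup G} {lam : ℝ}

theorem metricEndo_add_of_Ad (hKH : K ≤ H) {X₁ X₂ : E} {d : G}
    (hX₁ : Ad E d X₁ ∈ (mOne b H : Submodule ℝ E)) (hX₂ : X₂ ∈ (mTwo b K H : Submodule ℝ E))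
    (hd : Ad E d X₂ = X₂) :
    metricEndo b K H lam (Ad E d (X₁ + lam • X₂) + (1 - lam) • X₂)
      = Ad E d (X₁ + lam • X₂) := by
  have hsum : Ad E d (X₁ + lam • X₂) + (1 - lam) • X₂ = Ad E d X₁ + X₂ := by
    rw [map_add, map_smul, hd]
    module
  rw [hsum, metricEndo_add hKH hX₁ hX₂, map_add, map_smul, hd]

variable {F : Type*} [NormedAddCommGroup F] [NormedSpace ℝ F] [ChartedSpace F (G ⧸ K)]
  [IsManifold 𝓘(ℝ, F) ∞ (G ⧸ K)] {g : SmoothMetric F (G ⧸ K)}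
  (hg : IsDeformedMetric b K H lam g) (hb : IsBiInvariant b) (hKH : K ≤ H)
  (hπ : Manifold.IsSubmersion 𝓘(ℝ, E) 𝓘(ℝ, F) ∞ (QuotientGroup.mk : G → G ⧸ K))
include hg hb hKH hπ

theorem IsDeformedMetric.momentum_twoStepCurve {X₁ X₂ : GroupLieAlgebra 𝓘(ℝ, E) G}
    (hX₁ : X₁ ∈ mOne b H) (hX₂ : X₂ ∈ mTwo b K H) (Z : E) (t : ℝ) :
    metForm g (twoStepCurve K (X₁ + lam • X₂) ((1 - lam) • X₂) t)
      (velocity F (twoStepCurve K (X₁ + lam • X₂) ((1 - lam) • X₂)) t)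
      (fundamentalField F Z (twoStepCurve K (X₁ + lam • X₂) ((1 - lam) • X₂) t))
      = metForm b 1 (X₁ + lam • X₂ : E) Z := by
  have : CompleteSpace E := FiniteDimensional.complete ℝ E
  obtain ⟨hinv, horigin⟩ := (isDeformedMetric_iff hπ hKH).1 hg
  set A : GroupLieAlgebra 𝓘(ℝ, E) G := X₁ + lam • X₂
  set C : GroupLieAlgebra 𝓘(ℝ, E) G := (1 - lam) • X₂ with hC
  have ho : ((lieExp (t • A) * lieExp (t • C) : G) : G ⧸ K)
      = (lieExp (t • A) * lieExp (t • C)) • ((1 : G) : G ⧸ K) :=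
    (congrArg (QuotientGroup.mk : G → G ⧸ K) (mul_one _)).symm
  rw [velocity_twoStepCurve hπ, twoStepCurve_eq]
  beta_reduce
  rw [fundamentalField_mk hπ, ho, hinv.metForm_smul, horigin]
  set c : G := lieExp (t • A)
  set d : G := lieExp (t • C)
  have hd : d⁻¹ = lieExp ((-t) • C) := (lieExp_neg_smul C t).symm
  have hCH : C ∈ lieAlgebraOf H := Submodule.smul_mem _ _ hX₂.1
  have hAdX₁ : Ad E d⁻¹ X₁ ∈ (mOne b H : Submodule ℝ E) := by
    rw [hd]
    exact hb.Ad_lieExp_mem_mOne hCH hX₁ _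
  have hAdX₂ : Ad E d⁻¹ X₂ = X₂ := by
    rw [hd, hC, smul_smul]
    exact Ad_lieExp_self X₂ _
  have hAdA : Ad E c A = A := Ad_lieExp_self A t
  calc metForm b 1 (metricEndo b K H lam (mulLogDeriv (E := E) d A C)) (Ad E (c * d)⁻¹ Z)
      = metForm b 1 (Ad E d⁻¹ A) (Ad E d⁻¹ (Ad E c⁻¹ Z)) := by
        rw [mul_inv_rev, Ad_mul_apply]
        exact congrArg (metForm b 1 · _) (metricEndo_add_of_Ad hKH hAdX₁ hX₂ hAdX₂)
    _ = metForm b 1 A (Ad E c⁻¹ Z) := hb.metForm_Ad _ _ _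
    _ = metForm b 1 (Ad E c A) Z := (hb.metForm_Ad_left c A Z).symm
    _ = metForm b 1 A Z := by rw [hAdA]

theorem IsDeformedMetric.isGeodesicOn_twoStepCurve {X₁ X₂ : GroupLieAlgebra 𝓘(ℝ, E) G}
    (hX₁ : X₁ ∈ mOne b H) (hX₂ : X₂ ∈ mTwo b K H) :
    IsGeodesicOn g (twoStepCurve K (X₁ + lam • X₂) ((1 - lam) • X₂)) Set.univ := by
  have : CompleteSpace E := FiniteDimensional.complete ℝ E
  refine hg.1.isGeodesicOn_of_momentum_const hπ (contMDiff_twoStepCurve hπ _ _) fun Z t t' => ?_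
  exact (hg.momentum_twoStepCurve hb hKH hπ hX₁ hX₂ Z t).trans
    (hg.momentum_twoStepCurve hb hKH hπ hX₁ hX₂ Z t').symm

theorem IsDeformedMetric.eq_twoStepCurve {X₁ X₂ : GroupLieAlgebra 𝓘(ℝ, E) G}
    (hX₁ : X₁ ∈ mOne b H) (hX₂ : X₂ ∈ mTwo b K H) {J : Set ℝ} {γ : ℝ → G ⧸ K} (hJ : IsOpen J)
    (hJc : J.OrdConnected) (h0 : (0 : ℝ) ∈ J) (hγ : IsGeodesicOn g γ J)
    (hγ0 : γ 0 = QuotientGroup.mk 1) (hv : velocity F γ 0 = dProj F K (X₁ + X₂)) :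
    ∀ t ∈ J, γ t = twoStepCurve K (X₁ + lam • X₂) ((1 - lam) • X₂) t := by
  have : CompleteSpace E := FiniteDimensional.complete ℝ E
  have : FiniteDimensional ℝ F := finiteDimensional_of_isSubmersion_mk hπ
  have : IsTopologicalGroup G := topologicalGroup_of_lieGroup 𝓘(ℝ, E) ∞
  have : T1Space (G ⧸ K) := ChartedSpace.t1Space F (G ⧸ K)
  have : T2Space (G ⧸ K) := t2Space_quotient K
  exact hγ.eqOn ((hg.isGeodesicOn_twoStepCurve hb hKH hπ hX₁ hX₂).mono (Set.subset_univ J)) hJ hJc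
    h0 (hγ0.trans (twoStepCurve_zero _ _).symm)
    (hv.trans (velocity_twoStepCurve_deformed_zero hπ X₁ X₂ lam).symm)

theorem IsDeformedMetric.isTwoStepGOSpace : IsTwoStepGOSpace E K g := by
  intro J γ hJ hJc h0 hγ hγ0
  obtain ⟨X₁, X₂, hX₁, hX₂, hv⟩ := exists_mOne_mTwo b hKH hπ (velocity F γ 0)
  exact ⟨_, _, hg.eq_twoStepCurve hb hKH hπ hX₁ hX₂ hJ hJc h0 hγ hγ0 hv.symm⟩

end TwoStepGeodesics

end TwoStepGO

end

theorem mainTheorem1_general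
    {E : Type*} [NormedAddCommGroup E] [NormedSpace ℝ E] [FiniteDimensional ℝ E]
    {G : Type*} [TopologicalSpace G] [ChartedSpace E G] [Group G]
    [LieGroup 𝓘(ℝ, E) ∞ G]
    (b : TwoStepGO.SmoothMetric E G) (hb : TwoStepGO.IsBiInvariant b)
    (K H : Subgroup G) (hKH : K ≤ H)
    {E' : Type*} [NormedAddCommGroup E'] [NormedSpace ℝ E']
    [ChartedSpace E' (G ⧸ K)] [IsManifold 𝓘(ℝ, E') ∞ (G ⧸ K)]
    (hπ : Manifold.IsSubmersion 𝓘(ℝ, E) 𝓘(ℝ, E') ∞ (QuotientGroup.mk : G → G ⧸ K))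
    (lam : ℝ) (hlam : 0 < lam) :
    (∃! g : TwoStepGO.SmoothMetric E' (G ⧸ K), TwoStepGO.IsDeformedMetric b K H lam g) ∧
    ∀ g : TwoStepGO.SmoothMetric E' (G ⧸ K), TwoStepGO.IsDeformedMetric b K H lam g →
      TwoStepGO.IsTwoStepGOSpace E K g ∧
      (∀ v : TangentSpace 𝓘(ℝ, E') (QuotientGroup.mk 1 : G ⧸ K),
        ∃! X : GroupLieAlgebra 𝓘(ℝ, E) G × GroupLieAlgebra 𝓘(ℝ, E) G,
          X.1 ∈ TwoStepGO.mOne b H ∧ X.2 ∈ TwoStepGO.mTwo b K H ∧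
            TwoStepGO.dProj E' K (X.1 + X.2) = v) ∧
      ∀ X₁ ∈ TwoStepGO.mOne b H, ∀ X₂ ∈ TwoStepGO.mTwo b K H,
        (TwoStepGO.IsGeodesicOn g
            (TwoStepGO.twoStepCurve K (X₁ + lam • X₂) ((1 - lam) • X₂)) Set.univ ∧
          TwoStepGO.twoStepCurve K (X₁ + lam • X₂) ((1 - lam) • X₂) 0 = QuotientGroup.mk 1 ∧
          TwoStepGO.velocity E'
            (TwoStepGO.twoStepCurve K (X₁ + lam • X₂) ((1 - lam) • X₂)) 0
              = TwoStepGO.dProj E' K (X₁ + X₂)) ∧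
        ∀ (J : Set ℝ) (γ : ℝ → G ⧸ K), IsOpen J → J.OrdConnected → (0 : ℝ) ∈ J →
          TwoStepGO.IsGeodesicOn g γ J → γ 0 = QuotientGroup.mk 1 →
          TwoStepGO.velocity E' γ 0 = TwoStepGO.dProj E' K (X₁ + X₂) →
          ∀ t ∈ J, γ t = TwoStepGO.twoStepCurve K (X₁ + lam • X₂) ((1 - lam) • X₂) t :=
  ⟨TwoStepGO.existsUnique_isDeformedMetric hπ hb hKH hlam, fun _ hg =>
    ⟨hg.isTwoStepGOSpace hb hKH hπ, TwoStepGO.existsUnique_mOne_mTwo (F := E') b hKH hπ,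
      fun X₁ hX₁ X₂ hX₂ =>
        ⟨⟨hg.isGeodesicOn_twoStepCurve hb hKH hπ hX₁ hX₂, TwoStepGO.twoStepCurve_zero _ _,
          TwoStepGO.velocity_twoStepCurve_deformed_zero hπ X₁ X₂ lam⟩,
        fun _ _ hJ hJc h0 hγ hγ0 hv => hg.eq_twoStepCurve hb hKH hπ hX₁ hX₂ hJ hJc h0 hγ hγ0 hv⟩⟩⟩

theorem mainTheorem1
    {E : Type*} [NormedAddCommGroup E] [NormedSpace ℝ E] [FiniteDimensional ℝ E]
    {G : Type*} [TopologicalSpace G] [T2Space G] [ChartedSpace E G] [Group G]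
    [LieGroup 𝓘(ℝ, E) ∞ G]
    -- a bi-invariant Riemannian metric on `G`, with inner product `B = b.inner 1` on `𝔤`
    (b : TwoStepGO.SmoothMetric E G) (hb : TwoStepGO.IsBiInvariant b)
    -- closed connected subgroups `K ⊆ H` of `G`
    (K H : Subgroup G) (hKc : IsClosed (K : Set G)) (hHc : IsClosed (H : Set G))
    (hKconn : IsConnected (K : Set G)) (hHconn : IsConnected (H : Set G)) (hKH : K ≤ H)
    -- the manifold structure of `G/K`: the one for which the projection is a smooth submersion
    {E' : Type*} [NormedAddCommGroup E'] [NormedSpace ℝ E'] [FiniteDimensional ℝ E']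
    [ChartedSpace E' (G ⧸ K)] [IsManifold 𝓘(ℝ, E') ∞ (G ⧸ K)]
    (hπ : Manifold.IsSubmersion 𝓘(ℝ, E) 𝓘(ℝ, E') ∞ (QuotientGroup.mk : G → G ⧸ K))
    (lam : ℝ) (hlam : 0 < lam) :
    (∃! g : TwoStepGO.SmoothMetric E' (G ⧸ K), TwoStepGO.IsDeformedMetric b K H lam g) ∧
    ∀ g : TwoStepGO.SmoothMetric E' (G ⧸ K), TwoStepGO.IsDeformedMetric b K H lam g →
      TwoStepGO.IsTwoStepGOSpace E K g ∧
      -- every initial velocity is `X₁ + X₂` for a unique pair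
      (∀ v : TangentSpace 𝓘(ℝ, E') (QuotientGroup.mk 1 : G ⧸ K),
        ∃! X : GroupLieAlgebra 𝓘(ℝ, E) G × GroupLieAlgebra 𝓘(ℝ, E) G,
          X.1 ∈ TwoStepGO.mOne b H ∧ X.2 ∈ TwoStepGO.mTwo b K H ∧
            TwoStepGO.dProj E' K (X.1 + X.2) = v) ∧
      ∀ X₁ ∈ TwoStepGO.mOne b H, ∀ X₂ ∈ TwoStepGO.mTwo b K H,
        -- the explicit curve is a complete geodesic with initial velocity `X₁ + X₂`
        (TwoStepGO.IsGeodesicOn g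
            (TwoStepGO.twoStepCurve K (X₁ + lam • X₂) ((1 - lam) • X₂)) Set.univ ∧
          TwoStepGO.twoStepCurve K (X₁ + lam • X₂) ((1 - lam) • X₂) 0 = QuotientGroup.mk 1 ∧
          TwoStepGO.velocity E'
            (TwoStepGO.twoStepCurve K (X₁ + lam • X₂) ((1 - lam) • X₂)) 0
              = TwoStepGO.dProj E' K (X₁ + X₂)) ∧
        -- every geodesic through `o` with this initial velocity is that curve
        ∀ (J : Set ℝ) (γ : ℝ → G ⧸ K), IsOpen J → J.OrdConnected → (0 : ℝ) ∈ J →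
          TwoStepGO.IsGeodesicOn g γ J → γ 0 = QuotientGroup.mk 1 →
          TwoStepGO.velocity E' γ 0 = TwoStepGO.dProj E' K (X₁ + X₂) →
          ∀ t ∈ J, γ t = TwoStepGO.twoStepCurve K (X₁ + lam • X₂) ((1 - lam) • X₂) t := by
  exact mainTheorem1_general b hb K H hKH hπ lam hlam
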